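/- Let $k$ be an algebraically closed field of characteristic zero, let $n\ge 1$, and let $\alpha,\beta,\gamma\in k^n$ with indices taken in $\mathbb Z/n$. Let $Q$ be the quiver with vertex set $\mathbb Z/n$ and, for each vertex $i$, arrows $u_i\colon i\to i+1$ and $d_i\colon i+1\to i$; let $kQ$ be its path algebra, with paths multiplied by concatenation from left to right, and let $e_i$ be the trivial path at $i$. The quiver down-up algebra $H=H(\alpha,\beta,\gamma)$ is the quotient of $kQ$ by the relations, for all $i\in\mathbb Z/n$, $$d_{i-1}u_{i-1}u_i=\alpha_i u_id_iu_i+\beta_i u_iu_{i+1}d_{i+1}+\gamma_i u_i,\qquad d_id_{i-1}u_{i-1}=\alpha_i d_iu_id_i+\beta_i u_{i+1}d_{i+1}d_i+\gamma_i d_i .$$ For each $i$ let $k[u_id_i,d_{i-1}u_{i-1}]$ be the unital $k$-subalgebra of $e_iHe_i$ (whose unit is $e_i$) generated by $u_id_i$ and $d_{i-1}u_{i-1}$. The following are equivalent: 1. $\beta_i\neq 0$ for all $i$; 2. (right) $H$ is right noetherian; 3. (left) $H$ is left noetherian; 4. for all $i$, $k[u_id_i,d_{i-1}u_{i-1}]$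 is isomorphic as a $k$-algebra to the polynomial ring $k[X,Y]$; 5. for all $i$, $k[u_id_i,d_{i-1}u_{i-1}]$ is the polynomial ring in the variables $u_id_i$ and $d_{i-1}u_{i-1}$, i.e. there is a $k$-algebra isomorphism from $k[X,Y]$ to it with $X\mapsto u_id_i$ and $Y\mapsto d_{i-1}u_{i-1}$; 6. $H$ is a piecewise domain with respect to the complete set of orthogonal idempotents $(e_i)_{i\in\mathbb Z/n}$, i.e. for all $i,l,j$ and all $a\in e_iHe_l$, $b\in e_lHe_j$, $ab=0$ implies $a=0$ or $b=0$. -/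

import Mathlib

/-! ### The path algebra of a quiver -/

/-- A path in a quiver, with arbitrary source and target. -/
structure QuiverPath (V : Type*) [Quiver V] where
  source : V
  target : V
  path : Quiver.Path source target

/-- The path algebra `kQ` of a quiver `Q` with vertex type `V`: the vector space with basis the
paths of `Q` (including the trivial path at each vertex). -/
def PathAlgebra (k V : Type*) [Field k] [Quiver V] : Type _ := QuiverPath V →₀ k

namespace PathAlgebra

variable {k V : Type*} [Field k] [Quiver V]

noncomputable instance : AddCommGroup (PathAlgebra k V) :=
  inferInstanceAs (AddCommGroup (QuiverPath V →₀ k))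

noncomputable instance : Module k (PathAlgebra k V) :=
  inferInstanceAs (Module k (QuiverPath V →₀ k))

variable (k) in
/-- The basis vector of `kQ` given by a path. -/
noncomputable def ofPath (p : QuiverPath V) : PathAlgebra k V := Finsupp.single p 1

open Classical in
variable (k) in
/-- The product of two paths, read from left to right: the concatenation `pq` if the target of `p`
is the source of `q`, and `0` otherwise. -/
noncomputable def pathMul (p q : QuiverPath V) : PathAlgebra k V :=
  if h : q.source = p.target then
    ofPath k ⟨p.source, q.target, p.path.comp (q.path.cast h rfl)⟩
  else 0

/-- The bilinear extension of the product of paths. -/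
noncomputable def mulLin : PathAlgebra k V →ₗ[k] PathAlgebra k V →ₗ[k] PathAlgebra k V :=
  Finsupp.linearCombination k fun p : QuiverPath V =>
    Finsupp.linearCombination k fun q : QuiverPath V => pathMul k p q

noncomputable instance : Mul (PathAlgebra k V) := ⟨fun a b => mulLin a b⟩

/-- The unit of `kQ` is the sum of all trivial paths. -/
noncomputable instance [Fintype V] : One (PathAlgebra k V) :=
  ⟨∑ v : V, ofPath k ⟨v, v, Quiver.Path.nil⟩⟩

theorem mul_def (a b : PathAlgebra k V) : a * b = mulLin a b := rfl

theorem one_def [Fintype V] :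
    (1 : PathAlgebra k V) = ∑ v : V, ofPath k ⟨v, v, Quiver.Path.nil⟩ := rfl

theorem ofPath_mul_ofPath (p q : QuiverPath V) : ofPath k p * ofPath k q = pathMul k p q := by
  rw [mul_def, mulLin, ofPath, ofPath]
  erw [Finsupp.linearCombination_single, one_smul, Finsupp.linearCombination_single, one_smul]

theorem induction {P : PathAlgebra k V → Prop} (a : PathAlgebra k V) (h0 : P 0)
    (hadd : ∀ a b, P a → P b → P (a + b)) (hpath : ∀ (c : k) p, P (c • ofPath k p)) : P a := by
  refine Finsupp.induction_linear (motive := P) a h0 hadd fun p c => ?_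
  have h : c • ofPath k p = (Finsupp.single p c : QuiverPath V →₀ k) := by
    rw [ofPath]
    erw [Finsupp.smul_single, smul_eq_mul, mul_one]
  exact h ▸ hpath c p

theorem add_mul' (a b c : PathAlgebra k V) : (a + b) * c = a * c + b * c := by
  simp only [mul_def, map_add, LinearMap.add_apply]

theorem mul_add' (a b c : PathAlgebra k V) : a * (b + c) = a * b + a * c := by
  simp only [mul_def, map_add]

theorem zero_mul' (a : PathAlgebra k V) : 0 * a = 0 := by
  simp only [mul_def, map_zero, LinearMap.zero_apply]

theorem mul_zero' (a : PathAlgebra k V) : a * 0 = 0 := by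
  simp only [mul_def, map_zero]

theorem smul_mul' (c : k) (a b : PathAlgebra k V) : (c • a) * b = c • (a * b) := by
  simp only [mul_def, map_smul, LinearMap.smul_apply]

theorem mul_smul' (c : k) (a b : PathAlgebra k V) : a * (c • b) = c • (a * b) := by
  simp only [mul_def, map_smul]

theorem ofPath_assoc (p q r : QuiverPath V) :
    ofPath k p * ofPath k q * ofPath k r = ofPath k p * (ofPath k q * ofPath k r) := by
  obtain ⟨a, b, p⟩ := p
  obtain ⟨c, d, q⟩ := q
  obtain ⟨e, f, r⟩ := r
  simp only [ofPath_mul_ofPath, pathMul]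
  by_cases h1 : c = b
  · subst h1
    by_cases h2 : e = d
    · subst h2
      simp [ofPath_mul_ofPath, pathMul, Quiver.Path.comp_assoc]
    · simp [ofPath_mul_ofPath, pathMul, h2, mul_zero']
  · by_cases h2 : e = d
    · subst h2
      simp [ofPath_mul_ofPath, pathMul, h1, zero_mul']
    · simp [h1, h2, zero_mul', mul_zero']

theorem mul_assoc' (a b c : PathAlgebra k V) : a * b * c = a * (b * c) := by
  induction a using induction with
  | h0 => simp only [zero_mul']
  | hadd a a' h h' => simp only [add_mul', h, h']
  | hpath x p =>
    induction b using induction with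
    | h0 => simp only [zero_mul', mul_zero']
    | hadd b b' h h' => simp only [add_mul', mul_add', h, h']
    | hpath y q =>
      induction c using induction with
      | h0 => simp only [mul_zero']
      | hadd c c' h h' => simp only [mul_add', h, h']
      | hpath z r => simp only [smul_mul', mul_smul', ofPath_assoc]

theorem one_mul' [Fintype V] (a : PathAlgebra k V) : 1 * a = a := by
  induction a using induction with
  | h0 => exact mul_zero' _
  | hadd a b h h' => rw [mul_add', h, h']
  | hpath c p =>
    rw [mul_smul', one_def, mul_def, map_sum, LinearMap.sum_apply]
    simp only [← mul_def, ofPath_mul_ofPath]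
    rw [Finset.sum_eq_single p.source]
    · simp [pathMul]
    · intro v _ hv
      simp [pathMul, hv.symm]
    · simp

theorem mul_one' [Fintype V] (a : PathAlgebra k V) : a * 1 = a := by
  induction a using induction with
  | h0 => exact zero_mul' _
  | hadd a b h h' => rw [add_mul', h, h']
  | hpath c p =>
    rw [smul_mul', one_def, mul_def, map_sum]
    simp only [← mul_def, ofPath_mul_ofPath]
    rw [Finset.sum_eq_single p.target]
    · simp [pathMul]
    · intro v _ hv
      simp [pathMul, hv]
    · simp

noncomputable instance [Fintype V] : Ring (PathAlgebra k V) where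
  __ : AddCommGroup (PathAlgebra k V) := inferInstance
  mul := (· * ·)
  one := 1
  left_distrib := mul_add'
  right_distrib := add_mul'
  zero_mul := zero_mul'
  mul_zero := mul_zero'
  mul_assoc := mul_assoc'
  one_mul := one_mul'
  mul_one := mul_one'

noncomputable instance [Fintype V] : Algebra k (PathAlgebra k V) :=
  Algebra.ofModule smul_mul' (fun c a b => mul_smul' c a b)

end PathAlgebra

/-! ### Quiver down-up algebras -/

/-- The arrows of the double of the cyclic quiver with vertices `0, …, n - 1` (taken modulo `n`):
`u i : i ⟶ i + 1` and `d i : i + 1 ⟶ i` for each vertex `i`. For `n = 1` these are two loops. -/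
inductive DownUpArrow (n : ℕ) : ZMod n → ZMod n → Type
  | u (i : ZMod n) : DownUpArrow n i (i + 1)
  | d (i : ZMod n) : DownUpArrow n (i + 1) i

instance downUpQuiver (n : ℕ) : Quiver (ZMod n) := ⟨DownUpArrow n⟩

namespace DownUp

variable (k : Type*) [Field k] (n : ℕ) [NeZero n]

/-- The trivial path at the vertex `i`. -/
noncomputable def pathE (i : ZMod n) : PathAlgebra k (ZMod n) :=
  PathAlgebra.ofPath k ⟨i, i, Quiver.Path.nil⟩

/-- The arrow `u_i`, as an element of the path algebra. -/
noncomputable def pathU (i : ZMod n) : PathAlgebra k (ZMod n) :=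
  PathAlgebra.ofPath k ⟨i, i + 1, Quiver.Hom.toPath (V := ZMod n) (DownUpArrow.u i)⟩

/-- The arrow `d_i`, as an element of the path algebra. -/
noncomputable def pathD (i : ZMod n) : PathAlgebra k (ZMod n) :=
  PathAlgebra.ofPath k ⟨i + 1, i, Quiver.Hom.toPath (V := ZMod n) (DownUpArrow.d i)⟩

variable {k n}

/-- The defining relations of the quiver down-up algebra. -/
inductive Rel (α β γ : ZMod n → k) : PathAlgebra k (ZMod n) → PathAlgebra k (ZMod n) → Prop
  | duu (i : ZMod n) : Rel α β γ
      (pathD k n (i - 1) * pathU k n (i - 1) * pathU k n i)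
      (α i • (pathU k n i * pathD k n i * pathU k n i)
        + β i • (pathU k n i * pathU k n (i + 1) * pathD k n (i + 1))
        + γ i • pathU k n i)
  | ddu (i : ZMod n) : Rel α β γ
      (pathD k n i * pathD k n (i - 1) * pathU k n (i - 1))
      (α i • (pathD k n i * pathU k n i * pathD k n i)
        + β i • (pathU k n (i + 1) * pathD k n (i + 1) * pathD k n i)
        + γ i • pathD k n i)

end DownUp

/-- The quiver down-up algebra `H(α, β, γ)`: the quotient of the path algebra by the two-sided
ideal generated by the defining relations. -/
abbrev QuiverDownUpAlgebra {k : Type*} [Field k] {n : ℕ} [NeZero n] (α β γ : ZMod n → k) : Type _ :=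
  RingQuot (DownUp.Rel α β γ)

namespace QuiverDownUpAlgebra

variable {k : Type*} [Field k] {n : ℕ} [NeZero n] (α β γ : ZMod n → k)

/-- The vertex idempotent `e_i` of `H(α, β, γ)`. -/
noncomputable def e (i : ZMod n) : QuiverDownUpAlgebra α β γ :=
  RingQuot.mkAlgHom k (DownUp.Rel α β γ) (DownUp.pathE k n i)

/-- The image of the arrow `u_i` in `H(α, β, γ)`. -/
noncomputable def u (i : ZMod n) : QuiverDownUpAlgebra α β γ :=
  RingQuot.mkAlgHom k (DownUp.Rel α β γ) (DownUp.pathU k n i)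

/-- The image of the arrow `d_i` in `H(α, β, γ)`. -/
noncomputable def d (i : ZMod n) : QuiverDownUpAlgebra α β γ :=
  RingQuot.mkAlgHom k (DownUp.Rel α β γ) (DownUp.pathD k n i)

theorem e_mul_e (i : ZMod n) : e α β γ i * e α β γ i = e α β γ i := by
  simp [e, ← map_mul, DownUp.pathE, PathAlgebra.ofPath_mul_ofPath, PathAlgebra.pathMul]

theorem e_mul_u (i : ZMod n) : e α β γ i * u α β γ i = u α β γ i := by
  simp [e, u, ← map_mul, DownUp.pathE, DownUp.pathU, PathAlgebra.ofPath_mul_ofPath,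
    PathAlgebra.pathMul]
  rfl

theorem d_mul_e (i : ZMod n) : d α β γ i * e α β γ i = d α β γ i := by
  simp [e, d, ← map_mul, DownUp.pathE, DownUp.pathD, PathAlgebra.ofPath_mul_ofPath,
    PathAlgebra.pathMul]

theorem e_mul_d (i : ZMod n) : e α β γ i * d α β γ (i - 1) = d α β γ (i - 1) := by
  have h : i - 1 + 1 = i := sub_add_cancel i 1
  simp [e, d, ← map_mul, DownUp.pathE, DownUp.pathD, PathAlgebra.ofPath_mul_ofPath,
    PathAlgebra.pathMul]
  congr 2
  rw [QuiverPath.mk.injEq]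
  exact ⟨h.symm, rfl, Quiver.Path.cast_heq _ _ _⟩

theorem u_mul_e (i : ZMod n) : u α β γ (i - 1) * e α β γ i = u α β γ (i - 1) := by
  have h : i = i - 1 + 1 := (sub_add_cancel i 1).symm
  obtain ⟨j, rfl⟩ : ∃ j, i = j + 1 := ⟨i - 1, h⟩
  rw [add_sub_cancel_right]
  simp [e, u, ← map_mul, DownUp.pathE, DownUp.pathU, PathAlgebra.ofPath_mul_ofPath,
    PathAlgebra.pathMul]

theorem e_idem (i : ZMod n) : IsIdempotentElem (e α β γ i) := e_mul_e α β γ i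

/-- The element `u_i d_i` of the corner ring `e_i H e_i`, whose unit is `e_i`. -/
noncomputable def ud (i : ZMod n) : (e_idem α β γ i).Corner :=
  ⟨u α β γ i * d α β γ i, (Subsemigroup.mem_corner_iff (e_idem α β γ i)).2
    ⟨by rw [← mul_assoc, e_mul_u], by rw [mul_assoc, d_mul_e]⟩⟩

/-- The element `d_{i-1} u_{i-1}` of the corner ring `e_i H e_i`, whose unit is `e_i`. -/
noncomputable def du (i : ZMod n) : (e_idem α β γ i).Corner :=
  ⟨d α β γ (i - 1) * u α β γ (i - 1), (Subsemigroup.mem_corner_iff (e_idem α β γ i)).2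
    ⟨by rw [← mul_assoc, e_mul_d], by rw [mul_assoc, u_mul_e]⟩⟩

end QuiverDownUpAlgebra

/-! ### Corner algebras, piecewise domains -/

/-- The corner `eAe` of a `k`-algebra `A` at an idempotent `e`, with unit `e`, is a `k`-algebra with
the scalar action inherited from `A`. -/
instance cornerAlgebra {k A : Type*} [CommSemiring k] [Semiring A] [Algebra k A] {e : A}
    (he : IsIdempotentElem e) : Algebra k he.Corner where
  smul c x := ⟨c • x.1, by
    obtain ⟨x, a, rfl⟩ := x
    exact ⟨c • a, by simp⟩⟩
  algebraMap :=
    { toFun c := ⟨c • e, c • 1, by simp [he.eq]⟩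
      map_one' := Subtype.ext (one_smul k e)
      map_mul' a b := Subtype.ext
        (show (a * b) • e = (a • e) * (b • e) by
          rw [smul_mul_smul_comm, he.eq])
      map_zero' := Subtype.ext (zero_smul k e)
      map_add' a b := Subtype.ext (add_smul a b e) }
  commutes' c x := Subtype.ext <| by
    have h := (Subsemigroup.mem_corner_iff he).1 x.2
    change (c • e) * x.1 = x.1 * (c • e)
    rw [smul_mul_assoc, mul_smul_comm, h.1, h.2]
  smul_def' c x := Subtype.ext <| by
    have h := (Subsemigroup.mem_corner_iff he).1 x.2
    change c • x.1 = (c • e) * x.1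
    rw [smul_mul_assoc, h.1]

/-- A ring `R` with a complete set of orthogonal idempotents `e_i` is a piecewise domain if for all
`a ∈ e_i R e_l` and `b ∈ e_l R e_j`, `a * b = 0` implies `a = 0` or `b = 0`. -/
def IsPiecewiseDomain {ι R : Type*} [Fintype ι] [Ring R] (e : ι → R) : Prop :=
  CompleteOrthogonalIdempotents e ∧
    ∀ (i l j : ι) (a b : R), (∃ r, a = e i * r * e l) → (∃ s, b = e l * s * e j) →
      a * b = 0 → a = 0 ∨ b = 0

/-! Put `U = ∑ u_i` and `D = ∑ d_i`. Then `e_i U = U e_{i+1}` and `e_{i+1} D = D e_i`, and the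
relations become those of a down-up algebra whose coefficients are combinations of the `e_i`. They
imply that `UD` and `DU` commute. Let `S` be the commutative algebra generated by the `e_i`, `UD`
and `DU`. Then `S U ⊆ U S` and `D S ⊆ S D` always, while `S D ⊆ D S` and `U S ⊆ S U` hold when no
`β_i` vanishes.

Suppose that all `β_i ≠ 0`. Then `H` arises from the noetherian ring `S` by adjoining `U` and then
`D`, each time an element `x` with `B x + B = x B + B`; a skew Hilbert basis theorem
(`isNoetherianRing_of_leftPolys`) applies twice. Moreover `H e_l` is spanned by the `U^m p e_l` and
`D^m p e_l` with `p` a polynomial in `UD` and `DU`. These are tested on a module with basis indexed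
by `ℤ` over `k[X, Y]`, on which `D` is a plain shift and `p(UD, DU)` acts in degree `j` as `θ_j(p)`
for an automorphism `θ_j` (`exists_generic_normalForm`). Degree `0` shows that `UD e_i` and `DU e_i`
are algebraically independent; comparing top coefficients in the domain `k[X, Y]` shows that `H` is
a piecewise domain.

Suppose that `β_i = 0`. Then `a = e_i (DU - α_i UD - γ_i)` satisfies `a u_i = 0`, and Verma modules
show that `a` and `u_i` are nonzero, so `H` is not a piecewise domain. On a Verma module based at
`i`, `a` kills all basis vectors below the highest one, so `a D^N` is not in the left ideal
generated by the `a D^j` with `j < N`. Finally `a u_i d_i = 0` inside a polynomial ring would make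
one of the two generators superfluous, against Krull dimension `2`.

The anti-automorphism exchanging `u_i` and `d_i` identifies left and right noetherianity. -/

/-! ### Universal property of the path algebra. -/

namespace PathAlgebra

variable {k V A : Type*} [Field k] [Quiver V] [Ring A] [Algebra k A]

/-- The product of the values of the arrows along a path. -/
def pathEval (E : V → A) (F : ∀ a b : V, (a ⟶ b) → A) {a : V} :
    ∀ {b : V}, Quiver.Path a b → A
  | _, .nil => E a
  | _, .cons p f => pathEval E F p * F _ _ f

variable {E : V → A} {F : ∀ a b : V, (a ⟶ b) → A}

theorem pathEval_mul_target (hE : ∀ a, E a * E a = E a)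
    (hFE : ∀ a b (f : a ⟶ b), F a b f * E b = F a b f) {a b : V} (p : Quiver.Path a b) :
    pathEval E F p * E b = pathEval E F p := by
  cases p with
  | nil => exact hE a
  | cons p f => rw [pathEval, mul_assoc, hFE]

/-- The product along a path begins with `E` at its source, so no compatibility of `F` with `E` on
the left has to be assumed. -/
theorem source_mul_pathEval (hE : ∀ a, E a * E a = E a) {a b : V} (p : Quiver.Path a b) :
    E a * pathEval E F p = pathEval E F p := by
  induction p with
  | nil => exact hE a
  | cons p f ih => rw [pathEval, ← mul_assoc, ih]

theorem pathEval_comp (hE : ∀ a, E a * E a = E a)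
    (hFE : ∀ a b (f : a ⟶ b), F a b f * E b = F a b f) {a b c : V} (p : Quiver.Path a b)
    (q : Quiver.Path b c) : pathEval E F (p.comp q) = pathEval E F p * pathEval E F q := by
  induction q with
  | nil => exact (pathEval_mul_target hE hFE p).symm
  | cons q f ih => rw [Quiver.Path.comp_cons, pathEval, pathEval, ih, mul_assoc]

/-- The linear extension of `pathEval`. -/
noncomputable def evalLin (k : Type*) [Field k] [Algebra k A] (E : V → A)
    (F : ∀ a b : V, (a ⟶ b) → A) : PathAlgebra k V →ₗ[k] A :=
  Finsupp.linearCombination k fun p : QuiverPath V => pathEval E F p.path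

theorem evalLin_ofPath (p : QuiverPath V) :
    evalLin k E F (ofPath k p) = pathEval E F p.path := by
  rw [evalLin, ofPath]
  erw [Finsupp.linearCombination_single, one_smul]

variable [Fintype V]

theorem evalLin_one (hE : CompleteOrthogonalIdempotents E) : evalLin k E F 1 = 1 := by
  rw [one_def, map_sum, ← hE.complete]
  exact Finset.sum_congr rfl fun v _ => evalLin_ofPath _

theorem evalLin_mul (hE : CompleteOrthogonalIdempotents E)
    (hFE : ∀ a b (f : a ⟶ b), F a b f * E b = F a b f) (x y : PathAlgebra k V) :
    evalLin k E F (x * y) = evalLin k E F x * evalLin k E F y := by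
  have hE' : ∀ a, E a * E a = E a := fun a => hE.idem a
  induction x using induction with
  | h0 => rw [zero_mul, map_zero, zero_mul]
  | hadd x x' h h' => rw [add_mul, map_add, h, h', map_add, add_mul]
  | hpath c p =>
    induction y using induction with
    | h0 => rw [mul_zero, map_zero, mul_zero]
    | hadd y y' h h' => rw [mul_add, map_add, h, h', map_add, mul_add]
    | hpath c' q =>
      rw [smul_mul_smul_comm, map_smul, map_smul, map_smul, smul_mul_smul_comm,
        ofPath_mul_ofPath, evalLin_ofPath, evalLin_ofPath]
      congr 1
      obtain ⟨a, b, p⟩ := p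
      obtain ⟨b', d, q⟩ := q
      by_cases h : b' = b
      · subst h
        simp only [pathMul, dif_pos, evalLin_ofPath]
        exact pathEval_comp hE' hFE p q
      · simp only [pathMul, dif_neg h, map_zero]
        rw [← pathEval_mul_target hE' hFE p, ← source_mul_pathEval hE' q, mul_assoc,
          ← mul_assoc (E b), hE.ortho (Ne.symm h), zero_mul, mul_zero]

/-- The universal property of the path algebra. -/
noncomputable def lift (hE : CompleteOrthogonalIdempotents E)
    (hFE : ∀ a b (f : a ⟶ b), F a b f * E b = F a b f) : PathAlgebra k V →ₐ[k] A :=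
  AlgHom.ofLinearMap (evalLin k E F) (evalLin_one hE) (evalLin_mul hE hFE)

theorem lift_ofPath (hE : CompleteOrthogonalIdempotents E)
    (hFE : ∀ a b (f : a ⟶ b), F a b f * E b = F a b f) (p : QuiverPath V) :
    lift hE hFE (ofPath k p) = pathEval E F p.path := evalLin_ofPath p

theorem completeOrthogonalIdempotents :
    CompleteOrthogonalIdempotents fun v : V => ofPath k ⟨v, v, Quiver.Path.nil⟩ where
  idem v := by
    simp [IsIdempotentElem, ofPath_mul_ofPath, pathMul]
  ortho v w h := by
    simp [ofPath_mul_ofPath, pathMul, h.symm]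
  complete := rfl

end PathAlgebra

/-! ### The relations in terms of the sums of arrows. -/

namespace QuiverDownUpAlgebra

variable {k : Type*} [Field k] {n : ℕ} [NeZero n] (α β γ : ZMod n → k)

theorem completeOrthogonalIdempotents_e : CompleteOrthogonalIdempotents (e α β γ) :=
  PathAlgebra.completeOrthogonalIdempotents.map
    (RingQuot.mkAlgHom k (DownUp.Rel α β γ)).toRingHom

/-- The sum of all the arrows `u_i`. -/
noncomputable def U : QuiverDownUpAlgebra α β γ := ∑ i, u α β γ i

/-- The sum of all the arrows `d_i`. -/
noncomputable def D : QuiverDownUpAlgebra α β γ := ∑ i, d α β γ i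

variable {α β γ}

theorem e_mul_e_of_ne {i j : ZMod n} (h : i ≠ j) : e α β γ i * e α β γ j = 0 :=
  (completeOrthogonalIdempotents_e α β γ).ortho h

theorem u_mul_e_succ (i : ZMod n) : u α β γ i * e α β γ (i + 1) = u α β γ i := by
  simpa using u_mul_e α β γ (i + 1)

theorem e_succ_mul_d (i : ZMod n) : e α β γ (i + 1) * d α β γ i = d α β γ i := by
  simpa using e_mul_d α β γ (i + 1)

theorem e_mul_U (i : ZMod n) : e α β γ i * U α β γ = u α β γ i := by
  rw [U, Finset.mul_sum, Finset.sum_eq_single i, e_mul_u]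
  · intro j _ hj
    rw [← e_mul_u, ← mul_assoc, e_mul_e_of_ne hj.symm, zero_mul]
  · simp

theorem U_mul_e (i : ZMod n) : U α β γ * e α β γ (i + 1) = u α β γ i := by
  rw [U, Finset.sum_mul, Finset.sum_eq_single i, u_mul_e_succ]
  · intro j _ hj
    rw [← u_mul_e_succ, mul_assoc, e_mul_e_of_ne (by simpa using hj), mul_zero]
  · simp

theorem e_mul_D (i : ZMod n) : e α β γ (i + 1) * D α β γ = d α β γ i := by
  rw [D, Finset.mul_sum, Finset.sum_eq_single i, e_succ_mul_d]
  · intro j _ hj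
    rw [← e_succ_mul_d, ← mul_assoc, e_mul_e_of_ne (by simpa using hj.symm), zero_mul]
  · simp

theorem D_mul_e (i : ZMod n) : D α β γ * e α β γ i = d α β γ i := by
  rw [D, Finset.sum_mul, Finset.sum_eq_single i, d_mul_e]
  · intro j _ hj
    rw [← d_mul_e, mul_assoc, e_mul_e_of_ne hj, mul_zero]
  · simp

theorem e_mul_U_comm (i : ZMod n) : e α β γ i * U α β γ = U α β γ * e α β γ (i + 1) := by
  rw [e_mul_U, U_mul_e]

theorem e_mul_D_comm (i : ZMod n) : e α β γ (i + 1) * D α β γ = D α β γ * e α β γ i := by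
  rw [e_mul_D, D_mul_e]

theorem duu (i : ZMod n) : d α β γ (i - 1) * u α β γ (i - 1) * u α β γ i =
    α i • (u α β γ i * d α β γ i * u α β γ i) +
      β i • (u α β γ i * u α β γ (i + 1) * d α β γ (i + 1)) + γ i • u α β γ i := by
  simp only [u, d, ← map_mul, ← map_add, ← map_smul]
  exact RingQuot.mkAlgHom_rel k (DownUp.Rel.duu (α := α) (β := β) (γ := γ) i)

theorem ddu (i : ZMod n) : d α β γ i * d α β γ (i - 1) * u α β γ (i - 1) =
    α i • (d α β γ i * u α β γ i * d α β γ i) +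
      β i • (u α β γ (i + 1) * d α β γ (i + 1) * d α β γ i) + γ i • d α β γ i := by
  simp only [u, d, ← map_mul, ← map_add, ← map_smul]
  exact RingQuot.mkAlgHom_rel k (DownUp.Rel.ddu (α := α) (β := β) (γ := γ) i)

theorem u_mul_d (i : ZMod n) : u α β γ i * d α β γ i = e α β γ i * (U α β γ * D α β γ) := by
  rw [← e_mul_D, ← mul_assoc, u_mul_e_succ, ← e_mul_U, mul_assoc]

theorem d_mul_u (i : ZMod n) :
    d α β γ (i - 1) * u α β γ (i - 1) = e α β γ i * (D α β γ * U α β γ) := by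
  rw [← e_mul_U, ← mul_assoc, d_mul_e, ← e_mul_D, mul_assoc, sub_add_cancel]

/-- Since `e_i` commutes with `UD` and `DU`, the inner idempotents of the relation collapse into the
one in front. -/
theorem e_mul_DUU (i : ZMod n) : e α β γ i * (D α β γ * U α β γ * U α β γ) =
    e α β γ i * (α i • (U α β γ * D α β γ * U α β γ) + β i • (U α β γ * U α β γ * D α β γ)
      + γ i • U α β γ) := by
  have h := duu (α := α) (β := β) (γ := γ) i
  rw [d_mul_u, u_mul_d, mul_assoc (u α β γ i) (u α β γ (i + 1)), u_mul_d, ← e_mul_U,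
    ← mul_assoc (e α β γ i * U α β γ), mul_assoc (e α β γ i) (U α β γ) (e α β γ (i + 1)),
    ← e_mul_U_comm, ← mul_assoc (e α β γ i) (e α β γ i), e_mul_e] at h
  have hc (z : QuiverDownUpAlgebra α β γ) (hz : Commute (e α β γ i) z) :
      e α β γ i * z * (e α β γ i * U α β γ) = e α β γ i * z * U α β γ := by
    rw [← mul_assoc, hz.eq, mul_assoc z, e_mul_e]
  have hUD : Commute (e α β γ i) (U α β γ * D α β γ) := by
    rw [Commute, SemiconjBy, ← mul_assoc, e_mul_U_comm, mul_assoc, e_mul_D_comm, mul_assoc]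
  have hDU : Commute (e α β γ i) (D α β γ * U α β γ) := by
    obtain ⟨j, rfl⟩ : ∃ j, i = j + 1 := ⟨i - 1, (sub_add_cancel i 1).symm⟩
    rw [Commute, SemiconjBy, ← mul_assoc, e_mul_D_comm, mul_assoc, e_mul_U_comm, mul_assoc]
  rw [hc _ hUD, hc _ hDU] at h
  simpa only [mul_add, mul_smul_comm, mul_assoc] using h

theorem e_mul_DDU (i : ZMod n) : e α β γ (i + 1) * (D α β γ * D α β γ * U α β γ) =
    e α β γ (i + 1) * (α i • (D α β γ * U α β γ * D α β γ) + β i • (U α β γ * D α β γ * D α β γ)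
      + γ i • D α β γ) := by
  have h := ddu (α := α) (β := β) (γ := γ) i
  have hE (i : ZMod n) (z : QuiverDownUpAlgebra α β γ) :
      e α β γ i * (e α β γ i * z) = e α β γ i * z := by
    rw [← mul_assoc, e_mul_e]
  have hU (i : ZMod n) (z : QuiverDownUpAlgebra α β γ) :
      U α β γ * (e α β γ (i + 1) * z) = e α β γ i * (U α β γ * z) := by
    rw [← mul_assoc, ← e_mul_U_comm, mul_assoc]
  have hD (i : ZMod n) (z : QuiverDownUpAlgebra α β γ) :
      D α β γ * (e α β γ i * z) = e α β γ (i + 1) * (D α β γ * z) := by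
    rw [← mul_assoc, ← e_mul_D_comm, mul_assoc]
  rw [mul_assoc, d_mul_u] at h
  simp only [← e_mul_D, ← e_mul_U, mul_assoc, hE, hU, hD] at h
  simpa only [mul_add, mul_smul_comm, mul_assoc] using h

end QuiverDownUpAlgebra

/-! ### Universal property of the quiver down-up algebra. -/

/-- Elements of a `k`-algebra satisfying the relations of the quiver down-up algebra, with all the
arrows `u_i` (respectively `d_i`) collected in one element `U` (respectively `D`). -/
structure DownUpSystem {k : Type*} [Field k] {n : ℕ} [NeZero n] (α β γ : ZMod n → k)
    (A : Type*) [Ring A] [Algebra k A] where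
  E : ZMod n → A
  U : A
  D : A
  complete : CompleteOrthogonalIdempotents E
  E_mul_U : ∀ i, E i * U = U * E (i + 1)
  E_mul_D : ∀ i, E (i + 1) * D = D * E i
  duu : ∀ i, E i * (D * U * U) =
    E i * (α i • (U * D * U) + β i • (U * U * D) + γ i • U)
  ddu : ∀ i, E (i + 1) * (D * D * U) =
    E (i + 1) * (α i • (D * U * D) + β i • (U * D * D) + γ i • D)

namespace DownUpSystem

variable {k : Type*} [Field k] {n : ℕ} [NeZero n] {α β γ : ZMod n → k}
  {A : Type*} [Ring A] [Algebra k A] (S : DownUpSystem α β γ A)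

/-- The values of the arrows. -/
def arrow : ∀ i j : ZMod n, (i ⟶ j) → A
  | _, _, DownUpArrow.u i => S.E i * S.U
  | _, _, DownUpArrow.d i => S.E (i + 1) * S.D

theorem arrow_mul : ∀ (i j : ZMod n) (f : i ⟶ j), S.arrow i j f * S.E j = S.arrow i j f
  | _, _, DownUpArrow.u i => by rw [arrow, S.E_mul_U, mul_assoc, (S.complete.idem _).eq]
  | _, _, DownUpArrow.d i => by rw [arrow, S.E_mul_D, mul_assoc, (S.complete.idem _).eq]

/-- The homomorphism from the path algebra. -/
noncomputable def pathLift : PathAlgebra k (ZMod n) →ₐ[k] A :=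
  PathAlgebra.lift S.complete S.arrow_mul

theorem pathLift_E (i : ZMod n) : S.pathLift (DownUp.pathE k n i) = S.E i :=
  PathAlgebra.lift_ofPath _ _ _

theorem pathLift_U (i : ZMod n) : S.pathLift (DownUp.pathU k n i) = S.E i * S.U := by
  refine (PathAlgebra.lift_ofPath _ _ _).trans ?_
  change S.E i * (S.E i * S.U) = _
  rw [← mul_assoc, (S.complete.idem i).eq]

theorem pathLift_D (i : ZMod n) : S.pathLift (DownUp.pathD k n i) = S.E (i + 1) * S.D := by
  refine (PathAlgebra.lift_ofPath _ _ _).trans ?_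
  change S.E (i + 1) * (S.E (i + 1) * S.D) = _
  rw [← mul_assoc, (S.complete.idem _).eq]

theorem pathLift_rel (a b : PathAlgebra k (ZMod n)) (h : DownUp.Rel α β γ a b) :
    S.pathLift a = S.pathLift b := by
  -- Normal form for the comparison: every idempotent is pushed to the left of all `U` and `D`.
  have hE (i : ZMod n) (z : A) : S.E i * (S.E i * z) = S.E i * z := by
    rw [← mul_assoc, (S.complete.idem i).eq]
  have hU (i : ZMod n) (z : A) : S.U * (S.E i * z) = S.E (i - 1) * (S.U * z) := by
    obtain ⟨j, rfl⟩ : ∃ j, i = j + 1 := ⟨i - 1, (sub_add_cancel i 1).symm⟩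
    rw [← mul_assoc, ← S.E_mul_U, mul_assoc, add_sub_cancel_right]
  have hD (i : ZMod n) (z : A) : S.D * (S.E i * z) = S.E (i + 1) * (S.D * z) := by
    rw [← mul_assoc, ← S.E_mul_D, mul_assoc]
  cases h with
  | duu i =>
    have h := S.duu i
    simp only [mul_add, mul_smul_comm, mul_assoc] at h
    simp only [map_add, map_mul, map_smul, pathLift_U, pathLift_D, mul_assoc, sub_add_cancel,
      add_sub_cancel_right, hE, hU, hD, ← h]
  | ddu i =>
    have h := S.ddu i
    simp only [mul_add, mul_smul_comm, mul_assoc] at h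
    simp only [map_add, map_mul, map_smul, pathLift_U, pathLift_D, mul_assoc, sub_add_cancel,
      add_sub_cancel_right, hE, hU, hD, ← h]

/-- The universal property of the quiver down-up algebra. -/
noncomputable def lift : QuiverDownUpAlgebra α β γ →ₐ[k] A :=
  RingQuot.liftAlgHom k ⟨S.pathLift, S.pathLift_rel⟩

open QuiverDownUpAlgebra

@[simp] theorem lift_e (i : ZMod n) : S.lift (e α β γ i) = S.E i := by
  rw [lift, e, RingQuot.liftAlgHom_mkAlgHom_apply, pathLift_E]

@[simp] theorem lift_U : S.lift (QuiverDownUpAlgebra.U α β γ) = S.U := by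
  have (i : ZMod n) : S.lift (u α β γ i) = S.E i * S.U := by
    rw [lift, u, RingQuot.liftAlgHom_mkAlgHom_apply, pathLift_U]
  rw [QuiverDownUpAlgebra.U, map_sum, Finset.sum_congr rfl fun i _ => this i, ← Finset.sum_mul, S.complete.complete,
    one_mul]

@[simp] theorem lift_D : S.lift (QuiverDownUpAlgebra.D α β γ) = S.D := by
  have (i : ZMod n) : S.lift (d α β γ i) = S.E (i + 1) * S.D := by
    rw [lift, d, RingQuot.liftAlgHom_mkAlgHom_apply, pathLift_D]
  have hs : ∑ i, S.E (i + 1) = 1 :=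
    (Equiv.sum_comp (Equiv.addRight (1 : ZMod n)) S.E).trans S.complete.complete
  rw [QuiverDownUpAlgebra.D, map_sum, Finset.sum_congr rfl fun i _ => this i, ← Finset.sum_mul,
    hs, one_mul]

end DownUpSystem

/-! ### Generators and the anti-automorphism. -/

namespace QuiverDownUpAlgebra

variable {k : Type*} [Field k] {n : ℕ} [NeZero n] {α β γ : ZMod n → k}

variable (α β γ) in
/-- The vertex idempotents together with the two sums of arrows. -/
def generators : Set (QuiverDownUpAlgebra α β γ) :=
  Set.range (e α β γ) ∪ {U α β γ, D α β γ}

theorem U_mul_e' (i : ZMod n) : U α β γ * e α β γ i = e α β γ (i - 1) * U α β γ := by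
  rw [e_mul_U_comm, sub_add_cancel]

theorem U_mul_e_mul (i : ZMod n) (z : QuiverDownUpAlgebra α β γ) :
    U α β γ * (e α β γ i * z) = e α β γ (i - 1) * (U α β γ * z) := by
  rw [← mul_assoc, U_mul_e', mul_assoc]

theorem D_mul_e_mul (i : ZMod n) (z : QuiverDownUpAlgebra α β γ) :
    D α β γ * (e α β γ i * z) = e α β γ (i + 1) * (D α β γ * z) := by
  rw [← mul_assoc, ← e_mul_D_comm, mul_assoc]

/-- A path is a product of arrows, and each arrow is a vertex idempotent times `U` or `D`. -/
theorem adjoin_generators : Algebra.adjoin k (generators α β γ) = ⊤ := by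
  have he (i) : e α β γ i ∈ Algebra.adjoin k (generators α β γ) :=
    Algebra.subset_adjoin (Or.inl ⟨i, rfl⟩)
  have hu (i) : u α β γ i ∈ Algebra.adjoin k (generators α β γ) :=
    e_mul_U (α := α) (β := β) (γ := γ) i ▸
      mul_mem (he i) (Algebra.subset_adjoin (Or.inr (Or.inl rfl)))
  have hd (i) : d α β γ i ∈ Algebra.adjoin k (generators α β γ) :=
    e_mul_D (α := α) (β := β) (γ := γ) i ▸
      mul_mem (he (i + 1)) (Algebra.subset_adjoin (Or.inr (Or.inr rfl)))
  have hp (i j : ZMod n) (p : Quiver.Path i j) :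
      RingQuot.mkAlgHom k (DownUp.Rel α β γ) (PathAlgebra.ofPath k ⟨i, j, p⟩) ∈
        Algebra.adjoin k (generators α β γ) := by
    induction p with
    | nil => exact he i
    | @cons j l p f ih =>
      have hc : PathAlgebra.ofPath k ⟨i, l, p.cons f⟩ =
          PathAlgebra.ofPath k ⟨i, j, p⟩ * PathAlgebra.ofPath k ⟨j, l, Quiver.Hom.toPath f⟩ := by
        simp [PathAlgebra.ofPath_mul_ofPath, PathAlgebra.pathMul, Quiver.Hom.toPath]
      rw [hc, map_mul]
      refine mul_mem ih ?_
      exact match j, l, f with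
        | _, _, DownUpArrow.u j => hu j
        | _, _, DownUpArrow.d j => hd j
  refine eq_top_iff.2 fun z _ => ?_
  obtain ⟨a, rfl⟩ := RingQuot.mkAlgHom_surjective k (DownUp.Rel α β γ) z
  induction a using PathAlgebra.induction with
  | h0 => rw [map_zero]; exact zero_mem _
  | hadd a b ha hb => rw [map_add]; exact add_mem (ha trivial) (hb trivial)
  | hpath c p =>
    rw [map_smul]
    exact Subalgebra.smul_mem _ (hp _ _ p.path) c

theorem algHom_ext {A : Type*} [Ring A] [Algebra k A] {f g : QuiverDownUpAlgebra α β γ →ₐ[k] A}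
    (he : ∀ i, f (e α β γ i) = g (e α β γ i)) (hU : f (U α β γ) = g (U α β γ))
    (hD : f (D α β γ) = g (D α β γ)) : f = g := by
  refine AlgHom.ext_of_adjoin_eq_top adjoin_generators ?_
  rintro _ (⟨i, rfl⟩ | rfl | rfl)
  exacts [he i, hU, hD]

variable (α β γ) in
/-- The system in the opposite algebra that interchanges the arrows `u_i` and `d_i`. -/
noncomputable def opSystem : DownUpSystem α β γ (QuiverDownUpAlgebra α β γ)ᵐᵒᵖ where
  E i := .op (e α β γ i)
  U := .op (D α β γ)
  D := .op (U α β γ)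
  complete :=
    { idem i := congrArg MulOpposite.op (e_mul_e α β γ i)
      ortho i j h := congrArg MulOpposite.op (e_mul_e_of_ne h.symm)
      complete := by
        rw [← MulOpposite.op_one, ← (completeOrthogonalIdempotents_e α β γ).complete,
          Finset.op_sum] }
  E_mul_U i := congrArg MulOpposite.op (e_mul_D_comm i).symm
  E_mul_D i := congrArg MulOpposite.op (e_mul_U_comm i).symm
  -- Reversing products turns each of the two families of relations into the other.
  duu i := by
    apply MulOpposite.unop_injective
    simpa [mul_add, add_mul, mul_assoc, U_mul_e', U_mul_e_mul, D_mul_e_mul,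
      ← e_mul_D_comm] using e_mul_DDU (α := α) (β := β) (γ := γ) i
  ddu i := by
    apply MulOpposite.unop_injective
    obtain ⟨j, rfl⟩ : ∃ j, i = j + 1 := ⟨i - 1, (sub_add_cancel i 1).symm⟩
    simpa [mul_add, add_mul, mul_assoc, U_mul_e', U_mul_e_mul, D_mul_e_mul,
      ← e_mul_D_comm] using e_mul_DUU (α := α) (β := β) (γ := γ) (j + 1)

@[simp] theorem opSystem_E (i : ZMod n) : (opSystem α β γ).E i = .op (e α β γ i) := rfl

@[simp] theorem opSystem_U : (opSystem α β γ).U = .op (D α β γ) := rfl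

@[simp] theorem opSystem_D : (opSystem α β γ).D = .op (U α β γ) := rfl

theorem opSystem_lift_lift (z : QuiverDownUpAlgebra α β γ) :
    ((opSystem α β γ).lift ((opSystem α β γ).lift z).unop).unop = z := by
  have : ((AlgHom.opComm (opSystem α β γ).lift).comp (opSystem α β γ).lift) =
      AlgHom.id k _ := by
    apply algHom_ext <;> intros <;> simp
  exact DFunLike.congr_fun this z

variable (α β γ) in
/-- The anti-automorphism that interchanges the arrows `u_i` and `d_i`. -/
noncomputable def opEquiv :
    QuiverDownUpAlgebra α β γ ≃+* (QuiverDownUpAlgebra α β γ)ᵐᵒᵖ :=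
  RingEquiv.ofRingHom (opSystem α β γ).lift.toRingHom
    (AlgHom.opComm (opSystem α β γ).lift).toRingHom
    (RingHom.ext fun z => MulOpposite.unop_injective (opSystem_lift_lift z.unop))
    (RingHom.ext fun z => opSystem_lift_lift z)

/-- The right regular module is the left regular module of the opposite ring, which `opEquiv`
identifies with `H`. -/
theorem isNoetherian_op_iff :
    IsNoetherian (QuiverDownUpAlgebra α β γ)ᵐᵒᵖ (QuiverDownUpAlgebra α β γ) ↔
      IsNoetherian (QuiverDownUpAlgebra α β γ) (QuiverDownUpAlgebra α β γ) := by
  have h1 : IsNoetherian (QuiverDownUpAlgebra α β γ)ᵐᵒᵖ (QuiverDownUpAlgebra α β γ) ↔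
      IsNoetherianRing (QuiverDownUpAlgebra α β γ)ᵐᵒᵖ :=
    ⟨fun h => isNoetherian_of_linearEquiv (MulOpposite.opLinearEquiv _),
      fun h => isNoetherian_of_linearEquiv (MulOpposite.opLinearEquiv _).symm⟩
  rw [h1]
  exact ⟨fun h => isNoetherianRing_of_ringEquiv _ (opEquiv α β γ).symm,
    fun h => isNoetherianRing_of_ringEquiv _ (opEquiv α β γ)⟩

end QuiverDownUpAlgebra

/-! ### Weight modules. -/

/-- The linear map that sends the basis vector at `j` to `c j` times the basis vector at
`j + s`. -/
noncomputable def weightedShift {K : Type*} [CommRing K] (s : ℤ) (c : ℤ → K) :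
    Module.End K (ℤ →₀ K) :=
  Finsupp.linearCombination K fun j => Finsupp.single (j + s) (c j)

theorem weightedShift_single {K : Type*} [CommRing K] (s : ℤ) (c : ℤ → K) (j : ℤ) (a : K) :
    weightedShift s c (Finsupp.single j a) = Finsupp.single (j + s) (a * c j) := by
  rw [weightedShift, Finsupp.linearCombination_single, Finsupp.smul_single, smul_eq_mul]

namespace QuiverDownUpAlgebra

variable {k : Type*} [Field k] {n : ℕ} [NeZero n] (α β γ : ZMod n → k)

/-- The condition on the matrix coefficients `μ` of the raising operator and `ν` of the lowering
operator under which they define a module over the quiver down-up algebra, where the basis vector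
at `j` lives at the vertex `l - j`. -/
structure IsWeightSystem {K : Type*} [CommRing K] [Algebra k K] (l : ZMod n) (μ ν : ℤ → K) :
    Prop where
  raise : ∀ j : ℤ, μ j * (μ (j + 1) * ν (j + 1)) =
    μ j * (α (l - j - 1) • (μ j * ν j) + β (l - j - 1) • (μ (j - 1) * ν (j - 1)) +
      algebraMap k K (γ (l - j - 1)))
  lower : ∀ j : ℤ, ν j * (μ (j + 1) * ν (j + 1)) =
    ν j * (α (l - j - 1) • (μ j * ν j) + β (l - j - 1) • (μ (j - 1) * ν (j - 1)) +
      algebraMap k K (γ (l - j - 1)))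

namespace IsWeightSystem

variable {α β γ} {K : Type*} [CommRing K] [Algebra k K] {l : ZMod n} {μ ν : ℤ → K}

/-- The operators on the weight module. -/
noncomputable def system (h : IsWeightSystem α β γ l μ ν) :
    DownUpSystem α β γ (Module.End K (ℤ →₀ K)) where
  E i := weightedShift 0 fun j => if l - j = i then 1 else 0
  U := weightedShift 1 μ
  D := weightedShift (-1) fun j => ν (j - 1)
  complete :=
    { idem i := Finsupp.lhom_ext fun j a => by
        by_cases h1 : l - j = i <;>
          simp [weightedShift_single, h1, -Finsupp.single_mul]
      ortho i i' hi := Finsupp.lhom_ext fun j a => by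
        by_cases h1 : l - j = i'
        · simp [weightedShift_single, h1, hi.symm, -Finsupp.single_mul]
        · simp [weightedShift_single, h1, -Finsupp.single_mul]
      complete := Finsupp.lhom_ext fun j a => by
        simp [weightedShift_single, LinearMap.sum_apply, ← Finsupp.single_finsetSum,
          -Finsupp.single_mul] }
  E_mul_U i := Finsupp.lhom_ext fun j a => by
    have hi : l - ((j + 1 : ℤ) : ZMod n) = i ↔ l - j = i + 1 := by
      rw [Int.cast_add, Int.cast_one, sub_add_eq_sub_sub, sub_eq_iff_eq_add]
    simp only [Module.End.mul_apply, weightedShift_single, add_zero, hi]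
    by_cases h1 : l - j = i + 1 <;> simp [h1, -Finsupp.single_mul]
  E_mul_D i := Finsupp.lhom_ext fun j a => by
    have hi : l - ((j + -1 : ℤ) : ZMod n) = i + 1 ↔ l - j = i := by
      rw [Int.cast_add, Int.cast_neg, Int.cast_one, sub_add_eq_sub_sub, sub_neg_eq_add,
        add_left_inj]
    simp only [Module.End.mul_apply, weightedShift_single, add_zero, hi]
    by_cases h1 : l - j = i <;> simp [h1, -Finsupp.single_mul]
  duu i := Finsupp.lhom_ext fun j a => by
    simp only [Module.End.mul_apply, weightedShift_single, LinearMap.add_apply,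
      LinearMap.smul_apply, Finsupp.smul_single, add_neg_cancel_right, neg_add_cancel_right,
      add_sub_cancel_right, ← Finsupp.single_add, add_zero]
    congr 1
    by_cases hi : l - ((j + 1 : ℤ) : ZMod n) = i
    · rw [if_pos hi, mul_one, mul_one]
      rw [Int.cast_add, Int.cast_one, sub_add_eq_sub_sub] at hi
      subst hi
      have := h.raise j
      simp only [Algebra.smul_def, ← sub_eq_add_neg] at this ⊢
      linear_combination a * this
    · rw [if_neg hi, mul_zero, mul_zero]
  ddu i := Finsupp.lhom_ext fun j a => by
    simp only [Module.End.mul_apply, weightedShift_single, LinearMap.add_apply,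
      LinearMap.smul_apply, Finsupp.smul_single, add_neg_cancel_right, neg_add_cancel_right,
      add_sub_cancel_right, ← Finsupp.single_add, add_zero]
    congr 1
    by_cases hi : l - ((j + -1 : ℤ) : ZMod n) = i + 1
    · rw [if_pos hi, mul_one, mul_one]
      obtain rfl : l - ((j - 1 : ℤ) : ZMod n) - 1 = i := by
        rw [sub_eq_add_neg j, hi, add_sub_cancel_right]
      have := h.lower (j - 1)
      simp only [Algebra.smul_def, ← sub_eq_add_neg, sub_add_cancel] at this ⊢
      linear_combination a * this
    · rw [if_neg hi, mul_zero, mul_zero]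

/-- The action of the quiver down-up algebra on the weight module. -/
noncomputable def rep (h : IsWeightSystem α β γ l μ ν) :
    QuiverDownUpAlgebra α β γ →ₐ[k] Module.End K (ℤ →₀ K) :=
  h.system.lift

variable (h : IsWeightSystem α β γ l μ ν)

theorem rep_e (i : ZMod n) (j : ℤ) (a : K) :
    h.rep (e α β γ i) (Finsupp.single j a) = if l - j = i then Finsupp.single j a else 0 := by
  rw [rep, DownUpSystem.lift_e, system, weightedShift_single]
  split_ifs <;> simp

theorem rep_U (j : ℤ) (a : K) :
    h.rep (U α β γ) (Finsupp.single j a) = Finsupp.single (j + 1) (a * μ j) := by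
  rw [rep, DownUpSystem.lift_U, system, weightedShift_single]

theorem rep_D (j : ℤ) (a : K) :
    h.rep (D α β γ) (Finsupp.single j a) = Finsupp.single (j - 1) (a * ν (j - 1)) := by
  rw [rep, DownUpSystem.lift_D, system, weightedShift_single, sub_eq_add_neg]

end IsWeightSystem

end QuiverDownUpAlgebra

/-! ### A skew Hilbert basis theorem. -/

section SkewHilbert

variable {B C : Type*} [Ring B] [Ring C] (f : B →+* C) (x : C)

/-- The set of sums `∑ i < m, x ^ i * f (b i)`. -/
def leftPolys : ℕ → AddSubgroup C
  | 0 => ⊥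
  | m + 1 => f.range.toAddSubgroup ⊔ (leftPolys m).map (AddMonoidHom.mulLeft x)

theorem mem_leftPolys_succ {m : ℕ} {c : C} :
    c ∈ leftPolys f x (m + 1) ↔ ∃ b, ∃ p ∈ leftPolys f x m, c = f b + x * p := by
  rw [leftPolys, AddSubgroup.mem_sup]
  constructor
  · rintro ⟨_, ⟨b, rfl⟩, _, ⟨p, hp, rfl⟩, rfl⟩
    exact ⟨b, p, hp, rfl⟩
  · rintro ⟨b, p, hp, rfl⟩
    exact ⟨_, ⟨b, rfl⟩, _, ⟨p, hp, rfl⟩, rfl⟩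

theorem leftPolys_le_succ (m : ℕ) : leftPolys f x m ≤ leftPolys f x (m + 1) := by
  induction m with
  | zero => exact bot_le
  | succ m ih =>
    intro c hc
    obtain ⟨b, p, hp, rfl⟩ := (mem_leftPolys_succ f x).1 hc
    exact (mem_leftPolys_succ f x).2 ⟨b, p, ih hp, rfl⟩

theorem leftPolys_mono : Monotone (leftPolys f x) := monotone_nat_of_le_succ (leftPolys_le_succ f x)

theorem mul_mem_leftPolys_succ {m : ℕ} {c : C} (hc : c ∈ leftPolys f x m) :
    x * c ∈ leftPolys f x (m + 1) :=
  (mem_leftPolys_succ f x).2 ⟨0, c, hc, by rw [map_zero, zero_add]⟩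

/-- Splits off the leading term, where `mem_leftPolys_succ` splits off the constant term. -/
theorem mem_leftPolys_succ' {m : ℕ} {c : C} :
    c ∈ leftPolys f x (m + 1) ↔ ∃ b, ∃ p ∈ leftPolys f x m, c = x ^ m * f b + p := by
  induction m generalizing c with
  | zero =>
    rw [mem_leftPolys_succ]
    simp [leftPolys]
  | succ m ih =>
    rw [mem_leftPolys_succ]
    constructor
    · rintro ⟨b, p, hp, rfl⟩
      obtain ⟨b', p', hp', rfl⟩ := ih.1 hp
      refine ⟨b', f b + x * p', (mem_leftPolys_succ f x).2 ⟨b, p', hp', rfl⟩, ?_⟩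
      rw [pow_succ', mul_add, mul_assoc]
      abel
    · rintro ⟨b, p, hp, rfl⟩
      obtain ⟨b', p', hp', rfl⟩ := (mem_leftPolys_succ f x).1 hp
      refine ⟨b', x ^ m * f b + p', ih.2 ⟨b, p', hp', rfl⟩, ?_⟩
      rw [pow_succ', mul_add, mul_assoc]
      abel

variable {f x}

theorem map_mul_mem_leftPolys (h : ∀ b, ∃ b' b'', f b * x = x * f b' + f b'') {m : ℕ} (b : B)
    {c : C} (hc : c ∈ leftPolys f x m) : f b * c ∈ leftPolys f x m := by
  induction m generalizing b c with
  | zero =>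
    obtain rfl : c = 0 := hc
    rw [mul_zero]
    exact zero_mem _
  | succ m ih =>
    obtain ⟨b₀, p, hp, rfl⟩ := (mem_leftPolys_succ f x).1 hc
    obtain ⟨b', b'', hb⟩ := h b
    have : f b * (f b₀ + x * p) = f (b * b₀) + x * (f b' * p) + f b'' * p := by
      rw [mul_add, ← mul_assoc, hb, map_mul, add_mul, mul_assoc]
      abel
    rw [this]
    exact add_mem ((mem_leftPolys_succ f x).2 ⟨_, _, ih b' hp, rfl⟩)
      (leftPolys_le_succ f x m (ih b'' hp))

/-- Here `x B ⊆ B x + B` enters: a prescribed coefficient to the right of `x ^ m` is produced, up to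
lower terms, by a multiplication on the left. This makes the leading coefficients of a left ideal a
left ideal. -/
theorem exists_map_mul_pow (h : ∀ b, ∃ b' b'', f b * x = x * f b' + f b'')
    (h' : ∀ b, ∃ b' b'', x * f b = f b' * x + f b'') (m : ℕ) (b : B) :
    ∃ b', ∃ p ∈ leftPolys f x m, f b' * x ^ m = x ^ m * f b + p := by
  induction m generalizing b with
  | zero => exact ⟨b, 0, zero_mem _, by simp⟩
  | succ m ih =>
    obtain ⟨b₁, p, hp, h₁⟩ := ih b
    obtain ⟨b₂, b₃, h₂⟩ := h' b₁
    refine ⟨b₂, x * p - f b₃ * x ^ m, sub_mem (mul_mem_leftPolys_succ f x hp)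
      (map_mul_mem_leftPolys h b₃ ((mem_leftPolys_succ' f x).2 ⟨1, 0, zero_mem _, by simp⟩)), ?_⟩
    have h₃ := congrArg (x * ·) h₁
    simp only [← mul_assoc, mul_add, h₂, add_mul] at h₃
    rw [pow_succ', ← mul_assoc, eq_sub_of_add_eq h₃]
    abel

theorem mul_map_mem_leftPolys {m : ℕ} {c : C} (hc : c ∈ leftPolys f x m) (b : B) :
    c * f b ∈ leftPolys f x m := by
  induction m generalizing c with
  | zero =>
    obtain rfl : c = 0 := hc
    rw [zero_mul]
    exact zero_mem _
  | succ m ih =>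
    obtain ⟨b₀, p, hp, rfl⟩ := (mem_leftPolys_succ f x).1 hc
    exact (mem_leftPolys_succ f x).2 ⟨b₀ * b, _, ih hp, by rw [add_mul, map_mul, mul_assoc]⟩

/-- The leading coefficients of the elements of degree at most `m` of a left ideal. -/
def leadingIdeal (h : ∀ b, ∃ b' b'', f b * x = x * f b' + f b'')
    (h' : ∀ b, ∃ b' b'', x * f b = f b' * x + f b'') (I : Ideal C) (m : ℕ) : Ideal B where
  carrier := {b | ∃ p ∈ leftPolys f x m, x ^ m * f b + p ∈ I}
  zero_mem' := ⟨0, zero_mem _, by simp⟩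
  add_mem' := by
    rintro a b ⟨p, hp, hpI⟩ ⟨q, hq, hqI⟩
    refine ⟨p + q, add_mem hp hq, ?_⟩
    convert add_mem hpI hqI using 1
    rw [map_add, mul_add]
    abel
  smul_mem' := by
    rintro c b ⟨p, hp, hpI⟩
    obtain ⟨c', q, hq, hc⟩ := exists_map_mul_pow h h' m c
    refine ⟨q * f b + f c' * p, add_mem (mul_map_mem_leftPolys hq b)
      (map_mul_mem_leftPolys h c' hp), ?_⟩
    convert I.mul_mem_left (f c') hpI using 1
    rw [mul_add, ← mul_assoc, hc, smul_eq_mul, map_mul, add_mul, mul_assoc]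
    abel

variable (h : ∀ b, ∃ b' b'', f b * x = x * f b' + f b'')
  (h' : ∀ b, ∃ b' b'', x * f b = f b' * x + f b'')

theorem leadingIdeal_mono_left {I J : Ideal C} (hIJ : I ≤ J) (m : ℕ) :
    leadingIdeal h h' I m ≤ leadingIdeal h h' J m :=
  fun _ ⟨p, hp, hpI⟩ => ⟨p, hp, hIJ hpI⟩

theorem leadingIdeal_mono_right (I : Ideal C) : Monotone (leadingIdeal h h' I) := by
  refine monotone_nat_of_le_succ fun m => ?_
  rintro b ⟨p, hp, hpI⟩
  refine ⟨x * p, mul_mem_leftPolys_succ f x hp, ?_⟩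
  convert I.mul_mem_left x hpI using 1
  rw [mul_add, pow_succ', mul_assoc]

/-- Subtracting an element of `I` with the same leading term leaves an element of `J` of lower
degree. -/
theorem le_of_leadingIdeal_le (hC : ∀ c, ∃ m, c ∈ leftPolys f x m) {I J : Ideal C} (hIJ : I ≤ J)
    (hL : ∀ m, leadingIdeal h h' J m ≤ leadingIdeal h h' I m) : J ≤ I := by
  have key (m : ℕ) (c : C) (hc : c ∈ leftPolys f x m) (hcJ : c ∈ J) : c ∈ I := by
    induction m generalizing c with
    | zero =>
      obtain rfl : c = 0 := hc
      exact zero_mem _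
    | succ m ih =>
      obtain ⟨b, p, hp, rfl⟩ := (mem_leftPolys_succ' f x).1 hc
      obtain ⟨q, hq, hqI⟩ := hL m ⟨p, hp, hcJ⟩
      have := ih (p - q) (sub_mem hp hq) (by
        convert sub_mem hcJ (hIJ hqI) using 1
        abel)
      convert add_mem hqI this using 1
      abel
  intro c hc
  obtain ⟨m, hm⟩ := hC c
  exact key m c hm hc

/-- Hilbert's basis theorem for a ring generated by a noetherian ring `B` and one more element `x`
such that `B x + B = x B + B`. -/
theorem isNoetherianRing_of_leftPolys [IsNoetherianRing B]
    (h : ∀ b, ∃ b' b'', f b * x = x * f b' + f b'')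
    (h' : ∀ b, ∃ b' b'', x * f b = f b' * x + f b'')
    (hC : ∀ c, ∃ m, c ∈ leftPolys f x m) : IsNoetherianRing C := by
  rw [isNoetherianRing_iff, ← monotone_stabilizes_iff_noetherian]
  intro I
  have stab := monotone_stabilizes_iff_noetherian.2 (inferInstance : IsNoetherian B B)
  -- The diagonal chain settles all degrees `m ≥ M` at once; the finitely many degrees below `M` are
  -- settled one by one, by `N m`.
  obtain ⟨M, hM⟩ := stab ⟨fun m => leadingIdeal h h' (I m) m, fun a b hab =>
    (leadingIdeal_mono_left h h' (I.mono hab) a).trans (leadingIdeal_mono_right h h' _ hab)⟩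
  choose N hN using fun m => stab ⟨fun r => leadingIdeal h h' (I r) m, fun a b hab =>
    leadingIdeal_mono_left h h' (I.mono hab) m⟩
  change ∀ r, M ≤ r → leadingIdeal h h' (I M) M = leadingIdeal h h' (I r) r at hM
  change ∀ m r, N m ≤ r → leadingIdeal h h' (I (N m)) m = leadingIdeal h h' (I r) m at hN
  refine ⟨max M ((Finset.range M).sup N), fun r hr => le_antisymm (I.mono hr)
    (le_of_leadingIdeal_le h h' hC (I.mono hr) fun m => ?_)⟩
  rcases lt_or_ge m M with hm | hm
  · have hs : N m ≤ max M ((Finset.range M).sup N) :=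
      (Finset.le_sup (Finset.mem_range.2 hm)).trans (le_max_right _ _)
    rw [← hN m r (hs.trans hr), ← hN m _ hs]
  · calc leadingIdeal h h' (I r) m ≤ leadingIdeal h h' (I (max r m)) (max r m) :=
          (leadingIdeal_mono_left h h' (I.mono (le_max_left _ _)) m).trans
            (leadingIdeal_mono_right h h' _ (le_max_right _ _))
      _ = leadingIdeal h h' (I M) M := (hM _ (hm.trans (le_max_right _ _))).symm
      _ ≤ _ := (leadingIdeal_mono_left h h' (I.mono (le_max_left _ _)) M).trans
            (leadingIdeal_mono_right h h' _ hm)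

theorem mul_mem_leftPolys_add (h : ∀ b, ∃ b' b'', f b * x = x * f b' + f b'') {m m' : ℕ}
    {p q : C} (hp : p ∈ leftPolys f x m) (hq : q ∈ leftPolys f x m') :
    p * q ∈ leftPolys f x (m + m') := by
  induction m generalizing p with
  | zero =>
    obtain rfl : p = 0 := hp
    rw [zero_mul]
    exact zero_mem _
  | succ m ih =>
    obtain ⟨b, p, hp', rfl⟩ := (mem_leftPolys_succ f x).1 hp
    rw [add_mul, mul_assoc, Nat.succ_add]
    exact add_mem (leftPolys_mono f x (by lia) (map_mul_mem_leftPolys h b hq))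
      (mul_mem_leftPolys_succ f x (ih hp'))

theorem map_mem_leftPolys_one (b : B) : f b ∈ leftPolys f x 1 :=
  (mem_leftPolys_succ f x).2 ⟨b, 0, zero_mem _, by simp⟩

theorem mem_leftPolys_two : x ∈ leftPolys f x 2 := by
  simpa using mul_mem_leftPolys_succ f x (map_mem_leftPolys_one (f := f) (x := x) 1)

end SkewHilbert

/-! ### Commutation rules extended from generators. -/

section Adjoin

variable {k A B : Type*} [Field k] [Ring A] [Algebra k A] [Ring B] [Algebra k B]

theorem exists_mem_leftPolys_of_adjoin_eq_top {f : B →ₐ[k] A} {x : A}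
    (h : ∀ b, ∃ b' b'', f b * x = x * f b' + f b'') {s : Set A} (hs : Algebra.adjoin k s = ⊤)
    (hsf : ∀ g ∈ s, g ∈ f.range ∨ g = x) (c : A) : ∃ m, c ∈ leftPolys (f : B →+* A) x m := by
  have hc : c ∈ Algebra.adjoin k s := hs ▸ trivial
  induction hc using Algebra.adjoin_induction with
  | mem g hg =>
    rcases hsf g hg with ⟨b, rfl⟩ | rfl
    · exact ⟨1, map_mem_leftPolys_one (f := (f : B →+* A)) b⟩
    · exact ⟨2, mem_leftPolys_two⟩
  | algebraMap r =>
    refine ⟨1, ?_⟩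
    rw [← f.commutes r]
    exact map_mem_leftPolys_one (f := (f : B →+* A)) (algebraMap k B r)
  | add p q _ _ hp hq =>
    obtain ⟨m, hp⟩ := hp
    obtain ⟨m', hq⟩ := hq
    exact ⟨max m m', add_mem (leftPolys_mono _ x (le_max_left _ _) hp)
      (leftPolys_mono _ x (le_max_right _ _) hq)⟩
  | mul p q _ _ hp hq =>
    obtain ⟨m, hp⟩ := hp
    obtain ⟨m', hq⟩ := hq
    exact ⟨m + m', mul_mem_leftPolys_add h hp hq⟩

variable {G : Set A} {t : A}

theorem Algebra.exists_mul_eq_of_adjoin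
    (hG : ∀ g ∈ G, ∃ a ∈ Algebra.adjoin k G, g * t = t * a) {c : A}
    (hc : c ∈ Algebra.adjoin k G) : ∃ a ∈ Algebra.adjoin k G, c * t = t * a := by
  induction hc using Algebra.adjoin_induction with
  | mem g hg => exact hG g hg
  | algebraMap r => exact ⟨_, Subalgebra.algebraMap_mem _ r, Algebra.commutes r t⟩
  | add p q _ _ hp hq =>
    obtain ⟨a, ha, hp⟩ := hp
    obtain ⟨b, hb, hq⟩ := hq
    exact ⟨a + b, add_mem ha hb, by rw [add_mul, hp, hq, mul_add]⟩
  | mul p q _ _ hp hq =>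
    obtain ⟨a, ha, hp⟩ := hp
    obtain ⟨b, hb, hq⟩ := hq
    exact ⟨a * b, mul_mem ha hb, by rw [mul_assoc, hq, ← mul_assoc, hp, mul_assoc]⟩

theorem Algebra.exists_mul_eq_add_of_adjoin
    (hG : ∀ g ∈ G, ∃ a ∈ Algebra.adjoin k G, ∃ b ∈ Algebra.adjoin k G, g * t = t * a + b) {c : A}
    (hc : c ∈ Algebra.adjoin k G) :
    ∃ a ∈ Algebra.adjoin k G, ∃ b ∈ Algebra.adjoin k G, c * t = t * a + b := by
  induction hc using Algebra.adjoin_induction with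
  | mem g hg => exact hG g hg
  | algebraMap r =>
    exact ⟨_, Subalgebra.algebraMap_mem _ r, 0, zero_mem _, by rw [Algebra.commutes r t, add_zero]⟩
  | add p q _ _ hp hq =>
    obtain ⟨a, ha, b, hb, hp⟩ := hp
    obtain ⟨a', ha', b', hb', hq⟩ := hq
    exact ⟨a + a', add_mem ha ha', b + b', add_mem hb hb', by
      rw [add_mul, hp, hq, mul_add]; abel⟩
  | mul p q hp' hq' hp hq =>
    obtain ⟨a, ha, b, hb, hp⟩ := hp
    obtain ⟨a', ha', b', hb', hq⟩ := hq
    refine ⟨a * a', mul_mem ha ha', b * a' + p * b',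
      add_mem (mul_mem hb ha') (mul_mem hp' hb'), ?_⟩
    rw [mul_assoc, hq, mul_add, ← mul_assoc, hp, add_mul, mul_assoc, add_assoc]

theorem Algebra.exists_mul_eq_add_of_adjoin'
    (hG : ∀ g ∈ G, ∃ a ∈ Algebra.adjoin k G, ∃ b ∈ Algebra.adjoin k G, t * g = a * t + b) {c : A}
    (hc : c ∈ Algebra.adjoin k G) :
    ∃ a ∈ Algebra.adjoin k G, ∃ b ∈ Algebra.adjoin k G, t * c = a * t + b := by
  induction hc using Algebra.adjoin_induction with
  | mem g hg => exact hG g hg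
  | algebraMap r =>
    exact ⟨_, Subalgebra.algebraMap_mem _ r, 0, zero_mem _, by rw [Algebra.commutes r t, add_zero]⟩
  | add p q _ _ hp hq =>
    obtain ⟨a, ha, b, hb, hp⟩ := hp
    obtain ⟨a', ha', b', hb', hq⟩ := hq
    exact ⟨a + a', add_mem ha ha', b + b', add_mem hb hb', by
      rw [mul_add, hp, hq, add_mul]; abel⟩
  | mul p q hp' hq' hp hq =>
    obtain ⟨a, ha, b, hb, hp⟩ := hp
    obtain ⟨a', ha', b', hb', hq⟩ := hq
    refine ⟨a * a', mul_mem ha ha', a * b' + b * q,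
      add_mem (mul_mem ha hb') (mul_mem hb hq'), ?_⟩
    rw [← mul_assoc, hp, add_mul, mul_assoc, hq, mul_add, mul_assoc, add_assoc]

/-- A commuting family in an algebra is the image of the variables under a homomorphism from a
polynomial ring. -/
theorem MvPolynomial.exists_algHom_of_commute {ι : Type*} (a : ι → A)
    (h : ∀ i j, a i * a j = a j * a i) :
    ∃ φ : MvPolynomial ι k →ₐ[k] A, (∀ i, φ (MvPolynomial.X i) = a i) ∧
      φ.range = Algebra.adjoin k (Set.range a) := by
  have hcomm := Algebra.isMulCommutative_adjoin k (s := Set.range a) (by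
    rintro _ ⟨i, rfl⟩ _ ⟨j, rfl⟩
    exact h i j)
  let S := Algebra.adjoin k (Set.range a)
  let _ : CommSemiring S := { (inferInstance : Semiring S) with mul_comm := hcomm.is_comm.comm }
  let ψ : MvPolynomial ι k →ₐ[k] S :=
    MvPolynomial.aeval fun i => (⟨a i, Algebra.subset_adjoin ⟨i, rfl⟩⟩ : S)
  let φ : MvPolynomial ι k →ₐ[k] A := S.val.comp ψ
  have hφ (i) : φ (MvPolynomial.X i) = a i := by simp [φ, ψ]
  refine ⟨φ, hφ, ?_⟩
  rw [← Algebra.map_top, ← MvPolynomial.adjoin_range_X, AlgHom.map_adjoin, ← Set.range_comp]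
  exact congrArg (fun s => Algebra.adjoin k (Set.range s)) (_root_.funext hφ)

end Adjoin

/-! ### The commutative subalgebra and noetherianity. -/

namespace QuiverDownUpAlgebra

variable {k : Type*} [Field k] {n : ℕ} [NeZero n] {α β γ : ZMod n → k}

theorem ext_e_mul {a b : QuiverDownUpAlgebra α β γ} (h : ∀ i, e α β γ i * a = e α β γ i * b) :
    a = b := by
  rw [← one_mul a, ← one_mul b, ← (completeOrthogonalIdempotents_e α β γ).complete,
    Finset.sum_mul, Finset.sum_mul, Finset.sum_congr rfl fun i _ => h i]

theorem e_mul_D' (i : ZMod n) : e α β γ i * D α β γ = D α β γ * e α β γ (i - 1) := by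
  simpa using e_mul_D_comm (α := α) (β := β) (γ := γ) (i - 1)

theorem e_mul_UD (i : ZMod n) :
    e α β γ i * (U α β γ * D α β γ) = U α β γ * D α β γ * e α β γ i := by
  rw [← mul_assoc, e_mul_U_comm, mul_assoc, e_mul_D_comm, mul_assoc]

theorem e_mul_DU (i : ZMod n) :
    e α β γ i * (D α β γ * U α β γ) = D α β γ * U α β γ * e α β γ i := by
  rw [← mul_assoc, e_mul_D', mul_assoc, e_mul_U_comm, mul_assoc, sub_add_cancel]

/-- The first relation times `D` on the right and `U` times the second relation have the same
right-hand side, `α UDUD + β UUDD + γ UD`. -/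
theorem UD_mul_DU : U α β γ * D α β γ * (D α β γ * U α β γ) =
    D α β γ * U α β γ * (U α β γ * D α β γ) := by
  refine ext_e_mul fun i => ?_
  have h₁ := congrArg (· * D α β γ) (e_mul_DUU (α := α) (β := β) (γ := γ) i)
  have h₂ := congrArg (U α β γ * ·) (e_mul_DDU (α := α) (β := β) (γ := γ) i)
  simp only [← mul_assoc, ← e_mul_U_comm] at h₁ h₂ ⊢
  rw [h₁, h₂]
  simp only [mul_add, add_mul, mul_smul_comm, smul_mul_assoc, mul_assoc]

variable (α β γ) in
/-- The combination of the vertex idempotents with the given coefficients. -/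
noncomputable def diag (c : ZMod n → k) : QuiverDownUpAlgebra α β γ := ∑ i, c i • e α β γ i

theorem e_mul_diag (c : ZMod n → k) (i : ZMod n) :
    e α β γ i * diag α β γ c = c i • e α β γ i := by
  rw [diag, Finset.mul_sum, Finset.sum_eq_single i]
  · rw [mul_smul_comm, e_mul_e]
  · intro j _ hj
    rw [mul_smul_comm, e_mul_e_of_ne hj.symm, smul_zero]
  · simp

theorem e_mul_diag_mul (c : ZMod n → k) (i : ZMod n) (z : QuiverDownUpAlgebra α β γ) :
    e α β γ i * (diag α β γ c * z) = c i • (e α β γ i * z) := by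
  rw [← mul_assoc, e_mul_diag, smul_mul_assoc]

theorem diag_mul_U (c : ZMod n → k) :
    diag α β γ c * U α β γ = U α β γ * diag α β γ fun i => c (i - 1) := by
  refine ext_e_mul fun i => ?_
  rw [e_mul_diag_mul, ← mul_assoc, e_mul_U_comm, mul_assoc, e_mul_diag, add_sub_cancel_right,
    mul_smul_comm]

theorem D_mul_diag (c : ZMod n → k) :
    D α β γ * diag α β γ c = diag α β γ (fun i => c (i - 1)) * D α β γ := by
  refine ext_e_mul fun i => ?_
  rw [e_mul_diag_mul, ← mul_assoc, e_mul_D', mul_assoc, e_mul_diag, mul_smul_comm]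

theorem diag_inv_mul_diag {c : ZMod n → k} (hc : ∀ i, c i ≠ 0) :
    diag α β γ (fun i => (c i)⁻¹) * diag α β γ c = 1 := by
  refine ext_e_mul fun i => ?_
  rw [e_mul_diag_mul, e_mul_diag, smul_smul, inv_mul_cancel₀ (hc i), one_smul, mul_one]

theorem DUU_eq : D α β γ * U α β γ * U α β γ = diag α β γ α * (U α β γ * D α β γ * U α β γ) +
    diag α β γ β * (U α β γ * U α β γ * D α β γ) + diag α β γ γ * U α β γ := by
  refine ext_e_mul fun i => ?_
  rw [e_mul_DUU]
  simp only [mul_add, e_mul_diag_mul, mul_smul_comm]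

theorem DDU_eq : D α β γ * D α β γ * U α β γ =
    diag α β γ (fun i => α (i - 1)) * (D α β γ * U α β γ * D α β γ) +
    diag α β γ (fun i => β (i - 1)) * (U α β γ * D α β γ * D α β γ) +
    diag α β γ (fun i => γ (i - 1)) * D α β γ := by
  refine ext_e_mul fun i => ?_
  have h := e_mul_DDU (α := α) (β := β) (γ := γ) (i - 1)
  rw [sub_add_cancel] at h
  rw [h]
  simp only [mul_add, e_mul_diag_mul, mul_smul_comm]

variable (α β γ) in
/-- The generators of the commutative subalgebra of `H` that contains the vertex idempotents and
all the products `u_i d_i` and `d_i u_i`. -/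
noncomputable def commGenerators : ZMod n ⊕ Fin 2 → QuiverDownUpAlgebra α β γ :=
  Sum.elim (e α β γ) ![U α β γ * D α β γ, D α β γ * U α β γ]

theorem commGenerators_comm (i j : ZMod n ⊕ Fin 2) :
    commGenerators α β γ i * commGenerators α β γ j =
      commGenerators α β γ j * commGenerators α β γ i := by
  have hee (i j : ZMod n) : e α β γ i * e α β γ j = e α β γ j * e α β γ i := by
    rcases eq_or_ne i j with rfl | h
    · rfl
    · rw [e_mul_e_of_ne h, e_mul_e_of_ne h.symm]
  rcases i with i | i <;> rcases j with j | j
  · exact hee i j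
  · fin_cases j
    exacts [e_mul_UD i, e_mul_DU i]
  · fin_cases i
    exacts [(e_mul_UD j).symm, (e_mul_DU j).symm]
  · fin_cases i <;> fin_cases j
    exacts [rfl, UD_mul_DU, UD_mul_DU.symm, rfl]

variable (α β γ) in
/-- The commutative subalgebra of `H` generated by the vertex idempotents and all the products
`u_i d_i` and `d_i u_i`. -/
noncomputable def commSubalgebra : Subalgebra k (QuiverDownUpAlgebra α β γ) :=
  Algebra.adjoin k (Set.range (commGenerators α β γ))

theorem e_mem (i : ZMod n) : e α β γ i ∈ commSubalgebra α β γ :=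
  Algebra.subset_adjoin ⟨.inl i, rfl⟩

theorem UD_mem : U α β γ * D α β γ ∈ commSubalgebra α β γ :=
  Algebra.subset_adjoin ⟨.inr 0, rfl⟩

theorem DU_mem : D α β γ * U α β γ ∈ commSubalgebra α β γ :=
  Algebra.subset_adjoin ⟨.inr 1, rfl⟩

theorem diag_mem (c : ZMod n → k) : diag α β γ c ∈ commSubalgebra α β γ :=
  sum_mem fun i _ => Subalgebra.smul_mem _ (e_mem i) _

instance isNoetherianRing_commSubalgebra : IsNoetherianRing (commSubalgebra α β γ) := by
  obtain ⟨φ, -, hφ⟩ := MvPolynomial.exists_algHom_of_commute (k := k) (commGenerators α β γ)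
    commGenerators_comm
  rw [commSubalgebra, ← hφ]
  exact isNoetherianRing_of_surjective _ _ (RingHomClass.toRingHom φ.rangeRestrict)
    φ.rangeRestrict_surjective

theorem forall_commGenerators {P : QuiverDownUpAlgebra α β γ → Prop}
    (he : ∀ i, P (e α β γ i)) (hUD : P (U α β γ * D α β γ)) (hDU : P (D α β γ * U α β γ)) :
    ∀ g ∈ Set.range (commGenerators α β γ), P g := by
  rintro _ ⟨i | i, rfl⟩
  · exact he i
  · fin_cases i
    exacts [hUD, hDU]

/-- `UD · U = U · DU`, and the first relation writes `DU · U` with `U` in front once the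
coefficients are shifted by one vertex. -/
theorem comm_mul_U {s : QuiverDownUpAlgebra α β γ} (hs : s ∈ commSubalgebra α β γ) :
    ∃ s' ∈ commSubalgebra α β γ, s * U α β γ = U α β γ * s' := by
  refine Algebra.exists_mul_eq_of_adjoin (forall_commGenerators (fun i => ?_) ?_ ?_) hs
  · exact ⟨_, e_mem (i + 1), e_mul_U_comm i⟩
  · exact ⟨_, DU_mem, mul_assoc _ _ _⟩
  · refine ⟨diag α β γ (fun i => α (i - 1)) * (D α β γ * U α β γ) +
      diag α β γ (fun i => β (i - 1)) * (U α β γ * D α β γ) + diag α β γ fun i => γ (i - 1),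
      add_mem (add_mem (mul_mem (diag_mem _) DU_mem) (mul_mem (diag_mem _) UD_mem)) (diag_mem _),
      ?_⟩
    rw [DUU_eq, mul_add, mul_add, ← mul_assoc (U α β γ), ← mul_assoc (U α β γ), ← diag_mul_U,
      ← diag_mul_U, ← diag_mul_U]
    simp only [mul_assoc]

theorem D_mul_comm {s : QuiverDownUpAlgebra α β γ} (hs : s ∈ commSubalgebra α β γ) :
    ∃ s' ∈ commSubalgebra α β γ, ∃ t ∈ commSubalgebra α β γ, D α β γ * s = s' * D α β γ + t := by
  refine Algebra.exists_mul_eq_add_of_adjoin' (forall_commGenerators (fun i => ?_) ?_ ?_) hs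
  · exact ⟨_, e_mem (i + 1), 0, zero_mem _, by rw [add_zero, e_mul_D_comm]⟩
  · exact ⟨_, DU_mem, 0, zero_mem _, by rw [add_zero, mul_assoc]⟩
  · refine ⟨diag α β γ (fun i => α (i - 1)) * (D α β γ * U α β γ) +
      diag α β γ (fun i => β (i - 1)) * (U α β γ * D α β γ) + diag α β γ fun i => γ (i - 1),
      add_mem (add_mem (mul_mem (diag_mem _) DU_mem) (mul_mem (diag_mem _) UD_mem)) (diag_mem _),
      0, zero_mem _, ?_⟩
    rw [← mul_assoc, DDU_eq, add_zero]
    simp only [add_mul, mul_assoc]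

/-- The second relation is solved for `UD · D`, which requires dividing by its coefficient `β`. -/
theorem comm_mul_D (hβ : ∀ i, β i ≠ 0) {s : QuiverDownUpAlgebra α β γ}
    (hs : s ∈ commSubalgebra α β γ) :
    ∃ s' ∈ commSubalgebra α β γ, s * D α β γ = D α β γ * s' := by
  refine Algebra.exists_mul_eq_of_adjoin (forall_commGenerators (fun i => ?_) ?_ ?_) hs
  · exact ⟨_, e_mem (i - 1), e_mul_D' i⟩
  · refine ⟨diag α β γ (fun i => (β i)⁻¹) * (D α β γ * U α β γ -
      diag α β γ α * (U α β γ * D α β γ) - diag α β γ γ), mul_mem (diag_mem _) (sub_mem (sub_mem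
        DU_mem (mul_mem (diag_mem _) UD_mem)) (diag_mem _)), ?_⟩
    have h : D α β γ * (D α β γ * U α β γ - diag α β γ α * (U α β γ * D α β γ) - diag α β γ γ) =
        diag α β γ (fun i => β (i - 1)) * (U α β γ * D α β γ * D α β γ) := by
      rw [mul_sub, mul_sub, ← mul_assoc, DDU_eq, ← mul_assoc (D α β γ), D_mul_diag, D_mul_diag]
      simp only [mul_assoc]
      abel
    rw [← mul_assoc (D α β γ), D_mul_diag, mul_assoc (diag α β γ _), h,
      ← mul_assoc (diag α β γ _) (diag α β γ _),
      diag_inv_mul_diag (c := fun i => β (i - 1)) fun i => hβ _, one_mul]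
  · exact ⟨_, UD_mem, mul_assoc _ _ _⟩

theorem U_mul_comm (hβ : ∀ i, β i ≠ 0) {s : QuiverDownUpAlgebra α β γ}
    (hs : s ∈ commSubalgebra α β γ) :
    ∃ s' ∈ commSubalgebra α β γ, ∃ t ∈ commSubalgebra α β γ, U α β γ * s = s' * U α β γ + t := by
  refine Algebra.exists_mul_eq_add_of_adjoin' (forall_commGenerators (fun i => ?_) ?_ ?_) hs
  · exact ⟨_, e_mem (i - 1), 0, zero_mem _, by rw [add_zero, U_mul_e']⟩
  · refine ⟨diag α β γ (fun i => (β i)⁻¹) * (D α β γ * U α β γ -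
      diag α β γ α * (U α β γ * D α β γ) - diag α β γ γ), mul_mem (diag_mem _) (sub_mem (sub_mem
        DU_mem (mul_mem (diag_mem _) UD_mem)) (diag_mem _)), 0, zero_mem _, ?_⟩
    have h : (D α β γ * U α β γ - diag α β γ α * (U α β γ * D α β γ) - diag α β γ γ) * U α β γ =
        diag α β γ β * (U α β γ * (U α β γ * D α β γ)) := by
      rw [sub_mul, sub_mul, DUU_eq]
      simp only [mul_assoc]
      abel
    rw [add_zero, mul_assoc (diag α β γ _), h, ← mul_assoc (diag α β γ _) (diag α β γ _),
      diag_inv_mul_diag hβ, one_mul]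
  · exact ⟨_, UD_mem, 0, zero_mem _, by rw [add_zero, mul_assoc]⟩

variable (α β γ) in
/-- The subalgebra generated by the commutative subalgebra and `U`. -/
noncomputable def upperSubalgebra : Subalgebra k (QuiverDownUpAlgebra α β γ) :=
  Algebra.adjoin k (insert (U α β γ) (commSubalgebra α β γ : Set (QuiverDownUpAlgebra α β γ)))

theorem commSubalgebra_le : commSubalgebra α β γ ≤ upperSubalgebra α β γ :=
  fun _ hs => Algebra.subset_adjoin (Or.inr hs)

theorem isNoetherianRing_upperSubalgebra (hβ : ∀ i, β i ≠ 0) :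
    IsNoetherianRing (upperSubalgebra α β γ) := by
  let f := Subalgebra.inclusion (commSubalgebra_le (α := α) (β := β) (γ := γ))
  let x : upperSubalgebra α β γ := ⟨U α β γ, Algebra.subset_adjoin (Or.inl rfl)⟩
  have h (b) : ∃ b' b'', f b * x = x * f b' + f b'' := by
    obtain ⟨s, hs, hb⟩ := comm_mul_U b.2
    exact ⟨⟨s, hs⟩, 0, Subtype.ext (by simpa [f, x] using hb)⟩
  refine isNoetherianRing_of_leftPolys (f := RingHomClass.toRingHom f) (x := x) h (fun b => ?_)
    (exists_mem_leftPolys_of_adjoin_eq_top h Algebra.adjoin_adjoin_coe_preimage ?_)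
  · obtain ⟨s, hs, t, ht, hb⟩ := U_mul_comm hβ b.2
    exact ⟨⟨s, hs⟩, ⟨t, ht⟩, Subtype.ext (by simpa [f, x] using hb)⟩
  · rintro g (hg | hg)
    · exact Or.inr (Subtype.ext hg)
    · exact Or.inl ⟨⟨g, hg⟩, Subtype.ext rfl⟩

theorem isNoetherianRing_of_ne_zero (hβ : ∀ i, β i ≠ 0) :
    IsNoetherianRing (QuiverDownUpAlgebra α β γ) := by
  have := isNoetherianRing_upperSubalgebra (α := α) (γ := γ) hβ
  let f := (upperSubalgebra α β γ).val
  have hle := commSubalgebra_le (α := α) (β := β) (γ := γ)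
  have h (b) : ∃ b' b'', f b * D α β γ = D α β γ * f b' + f b'' := by
    obtain ⟨s, hs, t, ht, hb⟩ := Algebra.exists_mul_eq_add_of_adjoin (t := D α β γ) (by
      rintro g (rfl | hg)
      -- `UD` already lies in the subalgebra, so passing `D` across `U` leaves only a constant term.
      · exact ⟨0, zero_mem _, _, hle UD_mem, by rw [mul_zero, zero_add]⟩
      · obtain ⟨s, hs, h⟩ := comm_mul_D hβ hg
        exact ⟨s, hle hs, 0, zero_mem _, by rw [add_zero, h]⟩) b.2
    exact ⟨⟨s, hs⟩, ⟨t, ht⟩, hb⟩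
  refine isNoetherianRing_of_leftPolys (f := RingHomClass.toRingHom f) (x := D α β γ) h (fun b => ?_)
    (exists_mem_leftPolys_of_adjoin_eq_top h adjoin_generators ?_)
  · obtain ⟨s, hs, t, ht, hb⟩ := Algebra.exists_mul_eq_add_of_adjoin' (t := D α β γ) (by
      rintro g (rfl | hg)
      · exact ⟨0, zero_mem _, _, hle DU_mem, by rw [zero_mul, zero_add]⟩
      · obtain ⟨s, hs, t, ht, h⟩ := D_mul_comm hg
        exact ⟨s, hle hs, t, hle ht, h⟩) b.2
    exact ⟨⟨s, hs⟩, ⟨t, ht⟩, hb⟩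
  · rintro _ (⟨i, rfl⟩ | rfl | rfl)
    · exact Or.inl ⟨⟨_, hle (e_mem i)⟩, rfl⟩
    · exact Or.inl ⟨⟨_, Algebra.subset_adjoin (Or.inl rfl)⟩, rfl⟩
    · exact Or.inr rfl

end QuiverDownUpAlgebra

/-! ### Verma modules and the case of a vanishing `β_i`. -/

namespace QuiverDownUpAlgebra

variable {k : Type*} [Field k] {n : ℕ} (α β γ : ZMod n → k)

/-- The weights of the Verma module of highest weight `c` at the vertex `l`, preceded by a zero. -/
def vermaWeight (l : ZMod n) (c : k) : ℕ → k
  | 0 => 0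
  | 1 => c
  | m + 2 => α (l - m - 1) * vermaWeight l c (m + 1) + β (l - m - 1) * vermaWeight l c m +
      γ (l - m - 1)

/-- The factors `μ j` and `ν j` suspend the recurrence where both vanish, that is for `j < 0`, so
`c` is free. From `j = 0` on it is the recursion of `vermaWeight`, whose initial `0` is the value of
`UD` on the highest weight vector. -/
theorem isWeightSystem_verma (l : ZMod n) (c : k) :
    IsWeightSystem α β γ l (fun j => vermaWeight α β γ l c (j + 1).toNat)
      (fun j => if 0 ≤ j then 1 else 0) := by
  have hμν (j : ℤ) : vermaWeight α β γ l c (j + 1).toNat * (if 0 ≤ j then 1 else 0) =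
      vermaWeight α β γ l c (j + 1).toNat := by
    split_ifs with hj
    · rw [mul_one]
    · rw [Int.toNat_of_nonpos (by lia), vermaWeight, zero_mul]
  have hrec (j : ℤ) (hj : 0 ≤ j) : vermaWeight α β γ l c (j + 1 + 1).toNat =
      α (l - j - 1) * vermaWeight α β γ l c (j + 1).toNat +
        β (l - j - 1) * vermaWeight α β γ l c (j - 1 + 1).toNat + γ (l - j - 1) := by
    lift j to ℕ using hj
    have h₁ : ((j : ℤ) + 1 + 1).toNat = j + 2 := by lia
    have h₂ : ((j : ℤ) + 1).toNat = j + 1 := by lia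
    have h₃ : ((j : ℤ) - 1 + 1).toNat = j := by lia
    rw [h₁, h₂, h₃, vermaWeight, Int.cast_natCast]
  constructor
  · intro j
    simp only [hμν, smul_eq_mul, Algebra.algebraMap_self, RingHom.id_apply]
    rcases le_or_gt 0 j with hj | hj
    · rw [hrec j hj]
    · rw [Int.toNat_of_nonpos (by lia : j + 1 ≤ 0), vermaWeight, zero_mul, zero_mul]
  · intro j
    simp only [hμν, smul_eq_mul, Algebra.algebraMap_self, RingHom.id_apply]
    rcases le_or_gt 0 j with hj | hj
    · rw [hrec j hj]
    · rw [if_neg hj.not_ge, zero_mul, zero_mul]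

variable [NeZero n]

/-- The element `d_{i-1} u_{i-1} - α_i u_i d_i - γ_i e_i`. -/
noncomputable def defect (i : ZMod n) : QuiverDownUpAlgebra α β γ :=
  e α β γ i * (D α β γ * U α β γ - α i • (U α β γ * D α β γ) - γ i • 1)

variable {α β γ}

/-- By the first relation, `e_i (DU - α_i UD - γ_i) U = β_i e_i UUD`. -/
theorem defect_mul_u {i : ZMod n} (hi : β i = 0) : defect α β γ i * u α β γ i = 0 := by
  rw [defect, ← U_mul_e, ← mul_assoc, mul_assoc (e α β γ i), sub_mul, sub_mul, smul_mul_assoc,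
    smul_one_mul, mul_sub, mul_sub, e_mul_DUU, hi]
  simp [mul_add]

theorem e_mul_defect (i : ZMod n) : e α β γ i * defect α β γ i = defect α β γ i := by
  rw [defect, ← mul_assoc, e_mul_e]

theorem defect_mul_e (i : ZMod n) : defect α β γ i * e α β γ i = defect α β γ i := by
  have h : e α β γ i * (D α β γ * U α β γ - α i • (U α β γ * D α β γ) - γ i • 1) =
      (D α β γ * U α β γ - α i • (U α β γ * D α β γ) - γ i • 1) * e α β γ i := by
    simp only [mul_sub, sub_mul, e_mul_DU, e_mul_UD, mul_smul_comm, smul_mul_assoc, mul_one,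
      one_mul]
  rw [defect, h, mul_assoc, e_mul_e]

section Verma

variable (l : ZMod n) (c : k)

theorem verma_defect_zero :
    (isWeightSystem_verma α β γ l c).rep (defect α β γ l) (Finsupp.single 0 1) =
      Finsupp.single 0 (c - γ l) := by
  simp only [defect, map_mul, map_sub, map_smul, map_one, Module.End.mul_apply,
    LinearMap.sub_apply, LinearMap.smul_apply, Module.End.one_apply, IsWeightSystem.rep_D,
    IsWeightSystem.rep_U, IsWeightSystem.rep_e]
  simp [vermaWeight, ← Finsupp.single_sub]

/-- For `β_i = 0` the recursion of the weights reads `DU = α_i UD + γ_i` on basis vectors at the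
vertex `i` other than the highest one. -/
theorem verma_defect_succ {i : ZMod n} (hi : β i = 0) (m : ℕ) :
    (isWeightSystem_verma α β γ l c).rep (defect α β γ i) (Finsupp.single (m + 1 : ℤ) 1) = 0 := by
  simp only [defect, map_mul, map_sub, map_smul, map_one, Module.End.mul_apply,
    LinearMap.sub_apply, LinearMap.smul_apply, Module.End.one_apply, IsWeightSystem.rep_D,
    IsWeightSystem.rep_U, Finsupp.smul_single, add_sub_cancel_right,
    if_pos (by lia : (0 : ℤ) ≤ m + 1), if_pos (by lia : (0 : ℤ) ≤ m),
    ← Finsupp.single_sub, IsWeightSystem.rep_e]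
  split_ifs with h
  · have h₁ : ((m : ℤ) + 1 + 1).toNat = m + 2 := by lia
    have h₂ : ((m : ℤ) + 1).toNat = m + 1 := by lia
    have h₃ : l - m - 1 = i := by rw [← h]; push_cast; ring
    rw [h₁, h₂, vermaWeight, h₃, hi]
    simp
  · rfl

theorem verma_D_pow (j N : ℕ) (hj : j ≤ N) :
    (isWeightSystem_verma α β γ l c).rep (D α β γ ^ j) (Finsupp.single (N : ℤ) 1) =
      Finsupp.single ((N - j : ℕ) : ℤ) 1 := by
  induction j with
  | zero => simp
  | succ j ih =>
    rw [pow_succ', map_mul, Module.End.mul_apply, ih (by lia), IsWeightSystem.rep_D]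
    have : ((N - j : ℕ) : ℤ) - 1 = (N - (j + 1) : ℕ) := by lia
    rw [this, if_pos (by lia), mul_one]

end Verma

theorem defect_ne_zero (i : ZMod n) : defect α β γ i ≠ 0 := by
  intro h
  have := verma_defect_zero (α := α) (β := β) (γ := γ) i (γ i + 1)
  rw [h, map_zero, LinearMap.zero_apply, add_sub_cancel_left] at this
  exact Finsupp.single_ne_zero.2 one_ne_zero this.symm

theorem u_ne_zero (i : ZMod n) : u α β γ i ≠ 0 := by
  intro h
  have : (isWeightSystem_verma α β γ (i + 1) 1).rep (u α β γ i) (Finsupp.single 0 1) =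
      Finsupp.single 1 1 := by
    rw [← e_mul_U, map_mul, Module.End.mul_apply, IsWeightSystem.rep_U, IsWeightSystem.rep_e]
    simp [vermaWeight]
  rw [h, map_zero, LinearMap.zero_apply] at this
  exact Finsupp.single_ne_zero.2 one_ne_zero this.symm

theorem ne_zero_of_isPiecewiseDomain (h : IsPiecewiseDomain (e α β γ)) (i : ZMod n) : β i ≠ 0 := by
  intro hi
  rcases h.2 i i (i + 1) _ _ ⟨defect α β γ i, by rw [e_mul_defect, defect_mul_e]⟩
    ⟨u α β γ i, by rw [e_mul_u, u_mul_e_succ]⟩ (defect_mul_u hi) with h | h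
  · exact defect_ne_zero i h
  · exact u_ne_zero i h

/-- On the Verma module of highest weight `γ i + 1`, the products `defect i * D ^ j` with `j < N`
kill the basis vector at `N`, while `defect i * D ^ N` sends it to the highest weight vector. So the
left ideals generated by the former never stabilize. -/
theorem ne_zero_of_isNoetherianRing (h : IsNoetherianRing (QuiverDownUpAlgebra α β γ))
    (i : ZMod n) : β i ≠ 0 := by
  intro hi
  obtain ⟨N, hN⟩ := monotone_stabilizes_iff_noetherian.2 h
    ⟨fun N => Ideal.span ((fun j => defect α β γ i * D α β γ ^ j) '' Set.Iio N), fun a b hab =>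
      Ideal.span_mono (Set.image_mono (Set.Iio_subset_Iio hab))⟩
  change ∀ m, N ≤ m → Ideal.span ((fun j => defect α β γ i * D α β γ ^ j) '' Set.Iio N) =
    Ideal.span ((fun j => defect α β γ i * D α β γ ^ j) '' Set.Iio m) at hN
  have hmem : defect α β γ i * D α β γ ^ N ∈
      Ideal.span ((fun j => defect α β γ i * D α β γ ^ j) '' Set.Iio N) := by
    rw [hN (N + 1) (Nat.le_succ N)]
    exact Ideal.subset_span ⟨N, Nat.lt_succ_self N, rfl⟩
  have hrep (z) (hz : z ∈ Ideal.span ((fun j => defect α β γ i * D α β γ ^ j) '' Set.Iio N)) :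
      (isWeightSystem_verma α β γ i (γ i + 1)).rep z (Finsupp.single (N : ℤ) 1) = 0 := by
    induction hz using Submodule.span_induction with
    | mem z hz =>
      obtain ⟨j, hj, rfl⟩ := hz
      have hj : j < N := hj
      have : ((N - j : ℕ) : ℤ) = ((N - j - 1 : ℕ) : ℤ) + 1 := by lia
      simp only [map_mul, Module.End.mul_apply]
      rw [verma_D_pow _ _ _ _ hj.le, this, verma_defect_succ _ _ hi]
    | zero => rw [map_zero, LinearMap.zero_apply]
    | add a b _ _ ha hb => rw [map_add, LinearMap.add_apply, ha, hb, add_zero]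
    | smul a b _ hb => rw [smul_eq_mul, map_mul, Module.End.mul_apply, hb, map_zero]
  have := hrep _ hmem
  rw [map_mul, Module.End.mul_apply, verma_D_pow _ _ _ _ le_rfl, Nat.sub_self, Nat.cast_zero,
    verma_defect_zero, add_sub_cancel_left] at this
  exact Finsupp.single_ne_zero.2 one_ne_zero this

/-- A surjection from a polynomial ring in one variable would give Krull dimension `2 ≤ 1`. -/
theorem _root_.MvPolynomial.adjoin_singleton_ne_top (z : MvPolynomial (Fin 2) k) :
    Algebra.adjoin k {z} ≠ ⊤ := by
  intro h
  rw [Algebra.adjoin_singleton_eq_range_aeval, AlgHom.range_eq_top] at h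
  have := ringKrullDim_le_of_surjective (Polynomial.aeval (R := k) z).toRingHom h
  rw [MvPolynomial.ringKrullDim_of_isNoetherianRing, Polynomial.ringKrullDim_of_isNoetherianRing,
    ringKrullDim_eq_zero_of_field] at this
  simp at this

/-- For `β_i = 0` the generators satisfy `(y - α_i x - γ_i) x = 0`. In a domain one factor vanishes,
and then `x` or `y` alone generates everything. -/
theorem ne_zero_of_algEquiv {i : ZMod n}
    (φ : MvPolynomial (Fin 2) k ≃ₐ[k] Algebra.adjoin k {ud α β γ i, du α β γ i}) : β i ≠ 0 := by
  intro hi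
  let S := Algebra.adjoin k {ud α β γ i, du α β γ i}
  let x : S := ⟨ud α β γ i, Algebra.subset_adjoin (Or.inl rfl)⟩
  let y : S := ⟨du α β γ i, Algebra.subset_adjoin (Or.inr rfl)⟩
  have hxy : y * x = α i • (x * x) + γ i • x := by
    apply Subtype.ext
    apply Subtype.ext
    change d α β γ (i - 1) * u α β γ (i - 1) * (u α β γ i * d α β γ i) =
      α i • (u α β γ i * d α β γ i * (u α β γ i * d α β γ i)) + γ i • (u α β γ i * d α β γ i)
    rw [← mul_assoc, duu, hi]
    simp only [zero_smul, add_zero, add_mul, smul_mul_assoc, mul_assoc]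
  have hS : Algebra.adjoin k {x, y} = ⊤ := by
    have := Algebra.adjoin_adjoin_coe_preimage (R := k) (s := {ud α β γ i, du α β γ i})
    rw [← this]
    congr 1
    ext z
    simp [x, y, Subtype.ext_iff]
  have htop : Algebra.adjoin k {φ.symm x, φ.symm y} = ⊤ := by
    have := congrArg (Subalgebra.map (φ.symm : S →ₐ[k] MvPolynomial (Fin 2) k)) hS
    rw [AlgHom.map_adjoin, Set.image_pair, Algebra.map_top,
      (AlgHom.range_eq_top _).2 φ.symm.surjective] at this
    exact this
  have hprod := congrArg φ.symm hxy
  rw [map_mul, map_add, map_smul, map_smul, map_mul, ← sub_eq_zero] at hprod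
  replace hprod : (φ.symm y - (α i • φ.symm x + γ i • 1)) * φ.symm x = 0 := by
    rw [← hprod, sub_mul, add_mul, smul_mul_assoc, smul_mul_assoc, one_mul]
  rw [mul_eq_zero] at hprod
  rcases hprod with h | h
  · refine MvPolynomial.adjoin_singleton_ne_top (φ.symm x) (eq_top_iff.2 ?_)
    rw [← htop, Algebra.adjoin_le_iff]
    have hx : φ.symm x ∈ Algebra.adjoin k {φ.symm x} := Algebra.self_mem_adjoin_singleton k _
    rintro _ (rfl | rfl)
    · exact hx
    · rw [sub_eq_zero] at h
      rw [h]
      exact add_mem (Subalgebra.smul_mem _ hx _) (Subalgebra.smul_mem _ (one_mem _) _)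
  · refine MvPolynomial.adjoin_singleton_ne_top (φ.symm y) (eq_top_iff.2 ?_)
    rw [← htop, Algebra.adjoin_le_iff]
    rintro _ (rfl | rfl)
    · rw [h]; exact zero_mem _
    · exact Algebra.self_mem_adjoin_singleton k _

end QuiverDownUpAlgebra

/-! ### The generic weight module. -/

/-- Running the recursion towards negative indices uses inverses; this is why the `twist` maps have
to be automorphisms. -/
theorem Int.exists_seq_mul_eq {G : Type*} [Group G] (g : ℤ → G) :
    ∃ θ : ℤ → G, θ 0 = 1 ∧ ∀ j, θ (j + 1) = θ j * g j := by
  let p : ℕ → G := fun m => Nat.rec 1 (fun m x => x * g m) m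
  let q : ℕ → G := fun m => Nat.rec 1 (fun m x => x * (g (Int.negSucc m))⁻¹) m
  refine ⟨fun j => Int.casesOn j p fun m => q (m + 1), rfl, fun j => ?_⟩
  rcases j with m | m | m
  · rfl
  · exact (inv_mul_cancel_right (1 : G) _).symm
  · exact (inv_mul_cancel_right (q (m + 1)) _).symm

namespace QuiverDownUpAlgebra

open MvPolynomial

section Generic

variable {k : Type*} [Field k] {n : ℕ} (α β γ : ZMod n → k)

/-- The automorphism of the polynomial ring that passes from one vertex to the next. -/
noncomputable def twist (hβ : ∀ i, β i ≠ 0) (i : ZMod n) :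
    MvPolynomial (Fin 2) k ≃ₐ[k] MvPolynomial (Fin 2) k :=
  -- `X 0` and `X 1` stand for the eigenvalues of `UD` and `DU`; going back one step solves the
  -- recurrence for `X 0`, dividing by `β i`.
  AlgEquiv.ofAlgHom (aeval ![X 1, C (α i) * X 1 + C (β i) * X 0 + C (γ i)])
    (aeval ![C (β i)⁻¹ * (X 1 - C (α i) * X 0 - C (γ i)), X 0])
    (by
      have h : (C (β i)⁻¹ * C (β i) : MvPolynomial (Fin 2) k) = 1 := by
        rw [← C_mul, inv_mul_cancel₀ (hβ i), C_1]
      refine MvPolynomial.algHom_ext fun j => ?_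
      fin_cases j
      · simp only [Fin.zero_eta, AlgHom.comp_apply, aeval_X, Matrix.cons_val_zero,
          Matrix.cons_val_one, map_mul, map_sub, algHom_C, algebraMap_eq, AlgHom.id_apply]
        linear_combination X 0 * h
      · simp)
    (by
      have h : (C (β i) * C (β i)⁻¹ : MvPolynomial (Fin 2) k) = 1 := by
        rw [← C_mul, mul_inv_cancel₀ (hβ i), C_1]
      refine MvPolynomial.algHom_ext fun j => ?_
      fin_cases j
      · simp
      · simp only [Fin.mk_one, AlgHom.comp_apply, aeval_X, Matrix.cons_val_zero,
          Matrix.cons_val_one, map_add, map_mul, algHom_C, algebraMap_eq, AlgHom.id_apply]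
        linear_combination (X 1 - C (α i) * X 0 - C (γ i)) * h)

theorem twist_X_zero (hβ : ∀ i, β i ≠ 0) (i : ZMod n) : twist α β γ hβ i (X 0) = X 1 := by
  simp [twist]

theorem twist_X_one (hβ : ∀ i, β i ≠ 0) (i : ZMod n) :
    twist α β γ hβ i (X 1) = C (α i) * X 1 + C (β i) * X 0 + C (γ i) := by
  simp [twist]

/-- The composites of the automorphisms `twist`, starting from the vertex `l`. -/
noncomputable def twistSeq (hβ : ∀ i, β i ≠ 0) (l : ZMod n) :
    ℤ → MvPolynomial (Fin 2) k ≃ₐ[k] MvPolynomial (Fin 2) k :=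
  (Int.exists_seq_mul_eq fun j => twist α β γ hβ (l - j - 1)).choose

variable {α β γ} (hβ : ∀ i, β i ≠ 0) (l : ZMod n)

theorem twistSeq_zero : twistSeq α β γ hβ l 0 = 1 :=
  (Int.exists_seq_mul_eq fun j => twist α β γ hβ (l - j - 1)).choose_spec.1

theorem twistSeq_succ (j : ℤ) :
    twistSeq α β γ hβ l (j + 1) = twistSeq α β γ hβ l j * twist α β γ hβ (l - j - 1) :=
  (Int.exists_seq_mul_eq fun j => twist α β γ hβ (l - j - 1)).choose_spec.2 j

theorem twistSeq_X_zero (j : ℤ) :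
    twistSeq α β γ hβ l j (X 0) = twistSeq α β γ hβ l (j - 1) (X 1) := by
  obtain ⟨j, rfl⟩ : ∃ i, j = i + 1 := ⟨j - 1, by ring⟩
  rw [twistSeq_succ, AlgEquiv.mul_apply, twist_X_zero, add_sub_cancel_right]

/-- With lowering coefficients `1` both conditions are the bare recurrence, which is the image under
`twistSeq` of the definition of `twist`. -/
theorem isWeightSystem_generic :
    IsWeightSystem α β γ l (fun j => twistSeq α β γ hβ l j (X 1)) (fun _ => 1) := by
  have h (j : ℤ) : twistSeq α β γ hβ l (j + 1) (X 1) =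
      α (l - j - 1) • twistSeq α β γ hβ l j (X 1) +
        β (l - j - 1) • twistSeq α β γ hβ l (j - 1) (X 1) +
          algebraMap k _ (γ (l - j - 1)) := by
    rw [twistSeq_succ, AlgEquiv.mul_apply, twist_X_one, ← twistSeq_X_zero]
    simp only [map_add, map_mul, ← algebraMap_eq, AlgEquiv.commutes, Algebra.smul_def]
  constructor <;> intro j <;> simp only [mul_one, h]

theorem twistSeq_X_one_ne_zero (j : ℤ) : twistSeq α β γ hβ l j (X 1) ≠ 0 := by
  rw [Ne, EmbeddingLike.map_eq_zero_iff]
  exact X_ne_zero 1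

end Generic

/-! ### Normal forms in `H e_l`. -/

variable {k : Type*} [Field k] {n : ℕ} [NeZero n] {α β γ : ZMod n → k}

theorem exists_polyHom : ∃ q : MvPolynomial (Fin 2) k →ₐ[k] QuiverDownUpAlgebra α β γ,
    q (X 0) = U α β γ * D α β γ ∧ q (X 1) = D α β γ * U α β γ := by
  obtain ⟨q, hq, -⟩ := MvPolynomial.exists_algHom_of_commute (k := k)
    (fun i => commGenerators α β γ (.inr i)) fun i j => commGenerators_comm _ _
  exact ⟨q, hq 0, hq 1⟩

variable (α β γ) in
/-- The homomorphism from the polynomial ring that maps the variables to `UD` and `DU`. -/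
noncomputable def polyHom : MvPolynomial (Fin 2) k →ₐ[k] QuiverDownUpAlgebra α β γ :=
  exists_polyHom.choose

theorem polyHom_X_zero : polyHom α β γ (X 0) = U α β γ * D α β γ :=
  exists_polyHom.choose_spec.1

theorem polyHom_X_one : polyHom α β γ (X 1) = D α β γ * U α β γ :=
  exists_polyHom.choose_spec.2

theorem e_mul_polyHom (i : ZMod n) (p : MvPolynomial (Fin 2) k) :
    e α β γ i * polyHom α β γ p = polyHom α β γ p * e α β γ i := by
  induction p using MvPolynomial.induction_on with
  | C r => rw [← algebraMap_eq, AlgHom.commutes, Algebra.commutes]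
  | add p q hp hq => rw [map_add, mul_add, hp, hq, add_mul]
  | mul_X p j hp =>
    have hj : e α β γ i * polyHom α β γ (X j) = polyHom α β γ (X j) * e α β γ i := by
      fin_cases j
      · change _ * polyHom α β γ (X 0) = polyHom α β γ (X 0) * _
        rw [polyHom_X_zero, e_mul_UD]
      · change _ * polyHom α β γ (X 1) = polyHom α β γ (X 1) * _
        rw [polyHom_X_one, e_mul_DU]
    rw [map_mul, ← mul_assoc, hp, mul_assoc, hj, mul_assoc]

/-- Multiplied by `e_l`, every vertex idempotent becomes the scalar `0` or `1`, so only polynomials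
in `UD` and `DU` remain. -/
theorem comm_mul_e {s : QuiverDownUpAlgebra α β γ} (hs : s ∈ commSubalgebra α β γ) (l : ZMod n) :
    ∃ p, s * e α β γ l = polyHom α β γ p * e α β γ l := by
  induction hs using Algebra.adjoin_induction with
  | mem g hg =>
    refine forall_commGenerators (P := fun g => ∃ p, g * e α β γ l = polyHom α β γ p * e α β γ l)
      (fun i => ?_) ⟨X 0, by rw [polyHom_X_zero]⟩ ⟨X 1, by rw [polyHom_X_one]⟩ g hg
    rcases eq_or_ne i l with rfl | h
    · exact ⟨1, by rw [map_one, one_mul, e_mul_e]⟩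
    · exact ⟨0, by rw [map_zero, zero_mul, e_mul_e_of_ne h]⟩
  | algebraMap r => exact ⟨algebraMap k _ r, by rw [AlgHom.commutes]⟩
  | add a b _ _ ha hb =>
    obtain ⟨p, hp⟩ := ha
    obtain ⟨q, hq⟩ := hb
    exact ⟨p + q, by rw [add_mul, hp, hq, map_add, add_mul]⟩
  | mul a b _ _ ha hb =>
    obtain ⟨p, hp⟩ := ha
    obtain ⟨q, hq⟩ := hb
    exact ⟨p * q, by
      rw [mul_assoc, hq, ← e_mul_polyHom, ← mul_assoc, hp, mul_assoc, e_mul_polyHom, map_mul,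
        mul_assoc]⟩

variable (α β γ) in
/-- The powers of `U` (in nonnegative degrees) and of `D` (in nonpositive degrees). -/
noncomputable def power (m : ℤ) : QuiverDownUpAlgebra α β γ :=
  U α β γ ^ m.toNat * D α β γ ^ (-m).toNat

theorem power_natCast (m : ℕ) : power α β γ m = U α β γ ^ m := by
  simp [power]

theorem power_neg_natCast (m : ℕ) : power α β γ (-m) = D α β γ ^ m := by
  simp [power]

variable (α β γ) in
/-- The span of the products of powers of `U` or `D` with elements of the commutative
subalgebra. -/
noncomputable def powerSpan : Submodule k (QuiverDownUpAlgebra α β γ) :=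
  Submodule.span k {z | ∃ m, ∃ s ∈ commSubalgebra α β γ, z = power α β γ m * s}

theorem pow_U_mul_mem (m : ℕ) {s : QuiverDownUpAlgebra α β γ} (hs : s ∈ commSubalgebra α β γ) :
    U α β γ ^ m * s ∈ powerSpan α β γ :=
  Submodule.subset_span ⟨m, s, hs, by rw [power_natCast]⟩

theorem pow_D_mul_mem (m : ℕ) {s : QuiverDownUpAlgebra α β γ} (hs : s ∈ commSubalgebra α β γ) :
    D α β γ ^ m * s ∈ powerSpan α β γ :=
  Submodule.subset_span ⟨-m, s, hs, by rw [power_neg_natCast]⟩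

theorem exists_comm_mul_pow {z : QuiverDownUpAlgebra α β γ}
    (hz : ∀ s ∈ commSubalgebra α β γ, ∃ s' ∈ commSubalgebra α β γ, s * z = z * s') (m : ℕ)
    {s : QuiverDownUpAlgebra α β γ} (hs : s ∈ commSubalgebra α β γ) :
    ∃ s' ∈ commSubalgebra α β γ, s * z ^ m = z ^ m * s' := by
  induction m with
  | zero => exact ⟨s, hs, by simp⟩
  | succ m ih =>
    obtain ⟨s', hs', h⟩ := ih
    obtain ⟨t, ht, h'⟩ := hz s' hs'
    exact ⟨t, ht, by rw [pow_succ, ← mul_assoc, h, mul_assoc, h', mul_assoc]⟩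

/-- The span contains `1` and is stable under left multiplication by generators: in `D U^{m+1} =
(DU) U^m` and `U D^{m+1} = (UD) D^m` the bracket moves to the right past the power. -/
theorem powerSpan_eq_top (hβ : ∀ i, β i ≠ 0) : powerSpan α β γ = ⊤ := by
  have hU {s} (hs : s ∈ commSubalgebra α β γ) {t} (ht : t ∈ commSubalgebra α β γ) (m : ℕ) :
      s * (U α β γ ^ m * t) ∈ powerSpan α β γ := by
    obtain ⟨s', hs', h⟩ := exists_comm_mul_pow (fun s hs => comm_mul_U hs) m hs
    rw [← mul_assoc, h, mul_assoc]
    exact pow_U_mul_mem m (mul_mem hs' ht)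
  have hD {s} (hs : s ∈ commSubalgebra α β γ) {t} (ht : t ∈ commSubalgebra α β γ) (m : ℕ) :
      s * (D α β γ ^ m * t) ∈ powerSpan α β γ := by
    obtain ⟨s', hs', h⟩ := exists_comm_mul_pow (fun s hs => comm_mul_D hβ hs) m hs
    rw [← mul_assoc, h, mul_assoc]
    exact pow_D_mul_mem m (mul_mem hs' ht)
  have hgen (g) (hg : g ∈ generators α β γ) (m : ℤ) {s} (hs : s ∈ commSubalgebra α β γ) :
      g * (power α β γ m * s) ∈ powerSpan α β γ := by
    rcases Int.eq_nat_or_neg m with ⟨m, rfl | rfl⟩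
    · rw [power_natCast]
      rcases hg with ⟨i, rfl⟩ | rfl | rfl
      · exact hU (e_mem i) hs m
      · rw [← mul_assoc, ← pow_succ']
        exact pow_U_mul_mem _ hs
      · cases m with
        | zero => simpa using pow_D_mul_mem 1 hs
        | succ m =>
          rw [pow_succ', mul_assoc, ← mul_assoc]
          exact hU DU_mem hs m
    · rw [power_neg_natCast]
      rcases hg with ⟨i, rfl⟩ | rfl | rfl
      · exact hD (e_mem i) hs m
      · cases m with
        | zero => simpa using pow_U_mul_mem 1 hs
        | succ m =>
          rw [pow_succ', mul_assoc, ← mul_assoc]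
          exact hD UD_mem hs m
      · rw [← mul_assoc, ← pow_succ']
        exact pow_D_mul_mem _ hs
  have hmul (z) (hz : z ∈ Algebra.adjoin k (generators α β γ)) :
      ∀ w ∈ powerSpan α β γ, z * w ∈ powerSpan α β γ := by
    induction hz using Algebra.adjoin_induction with
    | mem g hg =>
      intro w hw
      induction hw using Submodule.span_induction with
      | mem w hw =>
        obtain ⟨m, s, hs, rfl⟩ := hw
        exact hgen g hg m hs
      | zero => rw [mul_zero]; exact zero_mem _
      | add a b _ _ ha hb => rw [mul_add]; exact add_mem ha hb
      | smul r a _ ha => rw [mul_smul_comm]; exact Submodule.smul_mem _ r ha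
    | algebraMap r =>
      intro w hw
      rw [← Algebra.smul_def]
      exact Submodule.smul_mem _ r hw
    | add a b _ _ ha hb =>
      intro w hw
      rw [add_mul]
      exact add_mem (ha w hw) (hb w hw)
    | mul a b _ _ ha hb =>
      intro w hw
      rw [mul_assoc]
      exact ha _ (hb w hw)
  refine eq_top_iff.2 fun z _ => ?_
  rw [← mul_one z]
  refine hmul z (adjoin_generators (α := α) (β := β) (γ := γ) ▸ trivial) 1 ?_
  simpa using pow_U_mul_mem (α := α) (β := β) (γ := γ) 0 (one_mem _)

variable (α β γ) in
/-- The element of `H e_l` with the given polynomial coefficients. -/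
noncomputable def normalForm (l : ZMod n) :
    (ℤ →₀ MvPolynomial (Fin 2) k) →ₗ[k] QuiverDownUpAlgebra α β γ :=
  Finsupp.lsum k fun m => LinearMap.mulLeft k (power α β γ m) ∘ₗ
    LinearMap.mulRight k (e α β γ l) ∘ₗ (polyHom α β γ).toLinearMap

theorem normalForm_single (l : ZMod n) (m : ℤ) (p : MvPolynomial (Fin 2) k) :
    normalForm α β γ l (Finsupp.single m p) =
      power α β γ m * (polyHom α β γ p * e α β γ l) := by
  rw [normalForm, Finsupp.lsum_single]
  rfl

theorem exists_normalForm (hβ : ∀ i, β i ≠ 0) (z : QuiverDownUpAlgebra α β γ) (l : ZMod n) :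
    ∃ F, normalForm α β γ l F = z * e α β γ l := by
  have : powerSpan α β γ ≤
      (LinearMap.range (normalForm α β γ l)).comap (LinearMap.mulRight k (e α β γ l)) := by
    refine Submodule.span_le.2 ?_
    rintro _ ⟨m, s, hs, rfl⟩
    obtain ⟨p, hp⟩ := comm_mul_e hs l
    refine ⟨Finsupp.single m p, ?_⟩
    rw [normalForm_single, ← hp, LinearMap.mulRight_apply, mul_assoc]
  rw [powerSpan_eq_top hβ] at this
  exact this (show z ∈ ⊤ from trivial)

/-! ### Action of normal forms on the generic module. -/

section Action

variable (hβ : ∀ i, β i ≠ 0) (l : ZMod n)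

theorem generic_polyHom (p : MvPolynomial (Fin 2) k) (j : ℤ) (a : MvPolynomial (Fin 2) k) :
    (isWeightSystem_generic (α := α) (γ := γ) hβ l).rep (polyHom α β γ p) (Finsupp.single j a) =
      Finsupp.single j (a * twistSeq α β γ hβ l j p) := by
  induction p using MvPolynomial.induction_on generalizing a with
  | C r =>
    rw [← algebraMap_eq, AlgHom.commutes, AlgHom.commutes, AlgEquiv.commutes,
      Module.algebraMap_end_apply, Finsupp.smul_single, Algebra.smul_def, mul_comm]
  | add p q hp hq => rw [map_add, map_add, LinearMap.add_apply, hp, hq, map_add, mul_add,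
      Finsupp.single_add]
  | mul_X p i hp =>
    have hi (a) : (isWeightSystem_generic (α := α) (γ := γ) hβ l).rep (polyHom α β γ (X i))
        (Finsupp.single j a) = Finsupp.single j (a * twistSeq α β γ hβ l j (X i)) := by
      fin_cases i
      · change IsWeightSystem.rep _ (polyHom α β γ (X 0)) _ =
          Finsupp.single j (a * twistSeq α β γ hβ l j (X 0))
        rw [polyHom_X_zero, map_mul, Module.End.mul_apply, IsWeightSystem.rep_D,
          IsWeightSystem.rep_U, twistSeq_X_zero, sub_add_cancel, mul_one]
      · change IsWeightSystem.rep _ (polyHom α β γ (X 1)) _ =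
          Finsupp.single j (a * twistSeq α β γ hβ l j (X 1))
        rw [polyHom_X_one, map_mul, Module.End.mul_apply, IsWeightSystem.rep_U,
          IsWeightSystem.rep_D, add_sub_cancel_right, mul_one]
    rw [map_mul, map_mul, Module.End.mul_apply, hi, hp, map_mul, mul_assoc,
      mul_comm (twistSeq α β γ hβ l j (X i))]

theorem exists_generic_pow_U (m : ℕ) (j : ℤ) : ∃ c ≠ 0, ∀ a,
    (isWeightSystem_generic (α := α) (γ := γ) hβ l).rep (U α β γ ^ m) (Finsupp.single j a) =
      Finsupp.single (j + m) (a * c) := by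
  induction m with
  | zero => exact ⟨1, one_ne_zero, by simp⟩
  | succ m ih =>
    obtain ⟨c, hc, h⟩ := ih
    refine ⟨_, mul_ne_zero hc (twistSeq_X_one_ne_zero (α := α) (γ := γ) hβ l (j + m)),
      fun a => ?_⟩
    rw [pow_succ', map_mul, Module.End.mul_apply, h, IsWeightSystem.rep_U, mul_assoc,
      Nat.cast_succ, add_assoc]

theorem generic_pow_D (m : ℕ) (j : ℤ) (a : MvPolynomial (Fin 2) k) :
    (isWeightSystem_generic (α := α) (γ := γ) hβ l).rep (D α β γ ^ m) (Finsupp.single j a) =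
      Finsupp.single (j - m) a := by
  induction m with
  | zero => simp
  | succ m ih =>
    rw [pow_succ', map_mul, Module.End.mul_apply, ih, IsWeightSystem.rep_D, mul_one,
      Nat.cast_succ, sub_sub]

theorem exists_generic_power (m j : ℤ) : ∃ c ≠ 0, ∀ a,
    (isWeightSystem_generic (α := α) (γ := γ) hβ l).rep (power α β γ m) (Finsupp.single j a) =
      Finsupp.single (j + m) (a * c) := by
  rcases Int.eq_nat_or_neg m with ⟨m, rfl | rfl⟩
  · rw [power_natCast]
    exact exists_generic_pow_U hβ l m j
  · rw [power_neg_natCast]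
    exact ⟨1, one_ne_zero, fun a => by rw [generic_pow_D, mul_one, sub_eq_add_neg]⟩

/-- Different powers shift by different amounts, so the coefficients of a normal form are read off
separately, each up to an automorphism and a nonzero factor. -/
theorem exists_generic_normalForm : ∃ c : ℤ → ℤ → MvPolynomial (Fin 2) k, (∀ m j, c m j ≠ 0) ∧
    ∀ (i : ZMod n) (F : ℤ →₀ MvPolynomial (Fin 2) k) (j : ℤ) (a : MvPolynomial (Fin 2) k) (s : ℤ),
      (isWeightSystem_generic (α := α) (γ := γ) hβ l).rep (normalForm α β γ i F)
        (Finsupp.single j a) s =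
      if l - j = i then a * twistSeq α β γ hβ l j (F (s - j)) * c (s - j) j else 0 := by
  choose c hc h using exists_generic_power (α := α) (γ := γ) hβ l
  refine ⟨c, hc, fun i F j a s => ?_⟩
  induction F using Finsupp.induction_linear with
  | zero => simp
  | add F G hF hG =>
    rw [map_add, map_add, LinearMap.add_apply, Finsupp.add_apply, hF, hG, Finsupp.add_apply,
      map_add]
    split_ifs
    · ring
    · rw [add_zero]
  | single m p =>
    rw [normalForm_single, map_mul, map_mul, Module.End.mul_apply, Module.End.mul_apply,
      IsWeightSystem.rep_e]
    split_ifs with hi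
    · rw [generic_polyHom, h, Finsupp.single_apply, Finsupp.single_apply]
      by_cases hs : j + m = s
      · have hm : m = s - j := by lia
        rw [if_pos hs, if_pos hm, hm]
      · rw [if_neg hs, if_neg (by lia), map_zero, mul_zero, zero_mul]
    · simp

end Action

/-! ### Piecewise domain and polynomial subalgebras. -/

theorem isPiecewiseDomain_of_ne_zero (hβ : ∀ i, β i ≠ 0) : IsPiecewiseDomain (e α β γ) := by
  refine ⟨completeOrthogonalIdempotents_e α β γ, ?_⟩
  rintro i l j a b ⟨r, hr⟩ ⟨r', hr'⟩ hab
  by_contra! hne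
  obtain ⟨F, hF⟩ := exists_normalForm hβ a l
  obtain ⟨G, hG⟩ := exists_normalForm hβ b j
  have hal : a * e α β γ l = a := by rw [hr, mul_assoc, e_mul_e]
  have hbj : b * e α β γ j = b := by rw [hr', mul_assoc, e_mul_e]
  have hlb : e α β γ l * b = b := by rw [hr', ← mul_assoc, ← mul_assoc, e_mul_e]
  rw [hal] at hF
  rw [hbj] at hG
  have hF0 : F.support.Nonempty := Finsupp.support_nonempty_iff.2 fun h =>
    hne.1 (by rw [← hF, h, map_zero])
  obtain ⟨c, hc, hrep⟩ := exists_generic_normalForm (α := α) (γ := γ) hβ j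
  set ρ := (isWeightSystem_generic (α := α) (γ := γ) hβ j).rep with hρ
  set w := ρ b (Finsupp.single 0 1) with hw
  have hw0 : w.support.Nonempty := by
    obtain ⟨m, hm⟩ := Finsupp.support_nonempty_iff.2 fun h : G = 0 =>
      hne.2 (by rw [← hG, h, map_zero])
    refine ⟨m, ?_⟩
    rw [Finsupp.mem_support_iff] at hm ⊢
    rw [hw, ← hG, hrep, if_pos (by simp), twistSeq_zero, sub_zero, one_mul]
    exact mul_ne_zero hm (hc _ _)
  have hsum (z) (s : ℤ) : ρ z w s = ∑ m ∈ w.support, ρ z (Finsupp.single m (w m)) s := by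
    conv_lhs => rw [← Finsupp.sum_single w, Finsupp.sum, map_sum, Finsupp.finsetSum_apply]
  -- Since `e_l b = b`, the vector `w` lives at the vertex `l`, so the normal form of `a` acts on
  -- all its components.
  have hvert (m : ℤ) (hm : m ∈ w.support) : j - m = l := by
    by_contra h
    have h₁ : ρ (e α β γ l) w m = 0 := by
      rw [hsum]
      refine Finset.sum_eq_zero fun m' _ => ?_
      rw [hρ, IsWeightSystem.rep_e]
      split_ifs with h'
      · rw [Finsupp.single_apply, if_neg]
        rintro rfl
        exact h h'
      · rfl
    rw [hw, ← Module.End.mul_apply, ← map_mul, hlb] at h₁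
    exact Finsupp.mem_support_iff.1 hm h₁
  have hzero (s : ℤ) : ρ a w s = 0 := by
    rw [hw, ← Module.End.mul_apply, ← map_mul, hab, map_zero]
    rfl
  -- In the top degree only the top terms of `w` and of `F` contribute, and their product is nonzero
  -- in the polynomial ring.
  replace hzero := hzero (w.support.max' hw0 + F.support.max' hF0)
  rw [hsum, Finset.sum_eq_single (w.support.max' hw0)] at hzero
  · rw [← hF, hrep, if_pos (hvert _ (Finset.max'_mem _ _)), add_sub_cancel_left] at hzero
    refine mul_ne_zero (mul_ne_zero ?_ ?_) (hc _ _) hzero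
    · exact Finsupp.mem_support_iff.1 (Finset.max'_mem _ _)
    · rw [Ne, EmbeddingLike.map_eq_zero_iff]
      exact Finsupp.mem_support_iff.1 (Finset.max'_mem _ _)
  · intro m hm hne
    rw [← hF, hrep, if_pos (hvert m hm)]
    have hlt : m < w.support.max' hw0 := lt_of_le_of_ne (Finset.le_max' _ _ hm) hne
    have : F (w.support.max' hw0 + F.support.max' hF0 - m) = 0 := by
      by_contra h
      have := Finset.le_max' _ _ (Finsupp.mem_support_iff.2 h)
      lia
    rw [this, map_zero, mul_zero, zero_mul]
  · exact fun h => absurd (Finset.max'_mem _ _) h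

theorem exists_algEquiv_of_ne_zero (hβ : ∀ i, β i ≠ 0) (i : ZMod n) :
    ∃ φ : MvPolynomial (Fin 2) k ≃ₐ[k] Algebra.adjoin k {ud α β γ i, du α β γ i},
      (φ (X 0)).1 = ud α β γ i ∧ (φ (X 1)).1 = du α β γ i := by
  have hcomm : ud α β γ i * du α β γ i = du α β γ i * ud α β γ i := by
    apply Subtype.ext
    change u α β γ i * d α β γ i * (d α β γ (i - 1) * u α β γ (i - 1)) =
      d α β γ (i - 1) * u α β γ (i - 1) * (u α β γ i * d α β γ i)
    have hUD : Commute (e α β γ i) (U α β γ * D α β γ) := e_mul_UD i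
    have hDU : Commute (e α β γ i) (D α β γ * U α β γ) := e_mul_DU i
    rw [u_mul_d, d_mul_u]
    exact ((Commute.refl _).mul_right hDU).mul_left (hUD.symm.mul_right UD_mul_DU)
  obtain ⟨φ, hφ, hrange⟩ := MvPolynomial.exists_algHom_of_commute (k := k)
    ![ud α β γ i, du α β γ i] (by
      intro a b
      fin_cases a <;> fin_cases b
      exacts [rfl, hcomm, hcomm.symm, rfl])
  have hval (p : MvPolynomial (Fin 2) k) : (φ p).1 = polyHom α β γ p * e α β γ i := by
    induction p using MvPolynomial.induction_on with
    | C r =>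
      rw [← algebraMap_eq, AlgHom.commutes, AlgHom.commutes, ← Algebra.smul_def]
      rfl
    | add p q hp hq =>
      rw [map_add, map_add, add_mul, ← hp, ← hq]
      rfl
    | mul_X p j hp =>
      have hj : (φ (X j)).1 = polyHom α β γ (X j) * e α β γ i := by
        rw [hφ]
        fin_cases j
        · exact (u_mul_d i).trans ((e_mul_UD i).trans (by rw [← polyHom_X_zero]; rfl))
        · exact (d_mul_u i).trans ((e_mul_DU i).trans (by rw [← polyHom_X_one]; rfl))
      rw [map_mul, map_mul]
      change (φ p).1 * (φ (X j)).1 = _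
      rw [hp, hj, mul_assoc, ← mul_assoc (e α β γ i), e_mul_polyHom, mul_assoc, e_mul_e,
        mul_assoc]
  have hinj : Function.Injective φ := by
    refine (injective_iff_map_eq_zero _).2 fun p hp => ?_
    have h : polyHom α β γ p * e α β γ i = 0 := by rw [← hval, hp]; rfl
    -- At the base vector `twistSeq` is the identity, so `φ p` acts on it as multiplication by `p`
    -- itself.
    have := congrArg (fun z => (isWeightSystem_generic (α := α) (γ := γ) hβ i).rep z
      (Finsupp.single 0 1)) h
    simp only [map_mul, Module.End.mul_apply, IsWeightSystem.rep_e, map_zero] at this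
    rw [if_pos (by simp), generic_polyHom, twistSeq_zero] at this
    simpa using this
  have hadj : φ.range = Algebra.adjoin k {ud α β γ i, du α β γ i} := by
    rw [hrange, Matrix.range_cons, Matrix.range_cons, Matrix.range_empty, Set.union_empty,
      Set.singleton_union]
  exact ⟨(AlgEquiv.ofInjective φ hinj).trans (Subalgebra.equivOfEq _ _ hadj), hφ 0, hφ 1⟩

end QuiverDownUpAlgebra

open QuiverDownUpAlgebra in
theorem theorem4p2 {k : Type*} [Field k] [IsAlgClosed k] [CharZero k] (n : ℕ) [NeZero n]
    (α β γ : ZMod n → k) :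
    List.TFAE [
      -- all `β i` are nonzero
      ∀ i, β i ≠ 0,
      -- `H` is right noetherian
      IsNoetherian (QuiverDownUpAlgebra α β γ)ᵐᵒᵖ (QuiverDownUpAlgebra α β γ),
      -- `H` is left noetherian
      IsNoetherian (QuiverDownUpAlgebra α β γ) (QuiverDownUpAlgebra α β γ),
      -- each `k[u_i d_i, d_{i-1} u_{i-1}]` is isomorphic to a polynomial ring in two variables
      ∀ i, Nonempty
        (MvPolynomial (Fin 2) k ≃ₐ[k] Algebra.adjoin k {ud α β γ i, du α β γ i}),
      -- each `k[u_i d_i, d_{i-1} u_{i-1}]` is the polynomial ring in these two elements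
      ∀ i, ∃ φ : MvPolynomial (Fin 2) k ≃ₐ[k] Algebra.adjoin k {ud α β γ i, du α β γ i},
        (φ (MvPolynomial.X 0)).1 = ud α β γ i ∧ (φ (MvPolynomial.X 1)).1 = du α β γ i,
      -- `H` is a piecewise domain with respect to the vertex idempotents
      IsPiecewiseDomain (e α β γ)] := by
  tfae_have 1 → 3 := isNoetherianRing_of_ne_zero
  tfae_have 3 → 1 := ne_zero_of_isNoetherianRing
  tfae_have 2 ↔ 3 := isNoetherian_op_iff
  tfae_have 1 → 5 := exists_algEquiv_of_ne_zero
  tfae_have 5 → 4 := fun h i => ⟨(h i).choose⟩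
  tfae_have 4 → 1 := fun h i => (h i).elim ne_zero_of_algEquiv
  tfae_have 1 → 6 := isPiecewiseDomain_of_ne_zero
  tfae_have 6 → 1 := ne_zero_of_isPiecewiseDomain
  tfae_finish
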